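/- A triangulation of a closed connected surface $S$ is a simple graph embedded in $S$ such that each face is a triangle and any two faces share at most one edge. Contracting an edge $ac$, with incident faces $abc$ and $acd$, means deleting $ac$, identifying $a$ with $c$, and removing one of the parallel edges $ab,cb$ and one of the parallel edges $ad,cd$. The edge is contractible if the result is again a triangulation of the same surface. A triangulation is irreducible if it has no contractible edge. Let $T$ be an irreducible triangulation of a closed connected surface $S$ other than the sphere, and let $w_1w_2w_3$ be a nonseparating 3-cycle of $T$ (that is, its complement in $S$ is connected). Let $T'$ be obtained from $T$ by the following cut/cap operation along $w_1w_2w_3$. (Two-sided case.) If $w_1w_2w_3$ is two-sided, cut $S$ along it. This gives two boundary 3-cycles $u'_1u'_2u'_3$ and $v'_1v'_2v'_3$, where $u'_i$ and $v'_i$ come from $w_i$. Cap them with the two faces $u'_1u'_2u'_3$ and $v'_1v'_2v'_3$. (One-sided case.) If $w_1w_2w_3$ is one-sided (a neighbourhood of it is a Möbius band), cut $S$ along it. This gives one boundary 6-cycle $u'_1u'_2u'_3v'_1v'_2v'_3$, where $u'_i$ and $v'_i$ come from $w_i$. Cap it with a new vertex $t'$ and the six faces $t'u'_1u'_2$, $t'u'_2u'_3$,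 $t'u'_3v'_1$, $t'v'_1v'_2$, $t'v'_2v'_3$, $t'v'_3u'_1$. The frame vertices and frame edges are the vertices and edges of the added faces. An interior edge is an edge neither of whose ends is a frame vertex. Let $T''$ be a triangulation obtained from $T'$ by successively contracting zero or more interior edges, each of them contractible at the moment it is contracted. Then: Every edge of $T''$ - is a frame edge, or - is not contractible in $T''$, or - is on a path in $T''$ of length at most 3 connecting $u'_i$ and $v'_i$ for some $i\in\{1,2,3\}$. Every vertex of $T''$ - is a frame vertex, or - is an end of an edge that is not contractible in $T''$, or - is, for some $1\le i<j\le 3$, on a path in $T''$ of length at most 3 connecting $u'_i$ and $v'_i$ and on a path in $T''$ of length at most 3 connecting $u'_j$ and $v'_j$. -/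

import Mathlib

namespace SurfTri

/-- A finite two-dimensional complex without isolated pieces, given by its set of faces, each face
being identified with its set of vertices. -/
abbrev FaceSet (V : Type*) := Finset (Finset V)

section Triangulations

variable {V : Type*} [DecidableEq V]

/-- `x` is a vertex of the complex. -/
def IsVertex (K : FaceSet V) (x : V) : Prop := ∃ F ∈ K, x ∈ F

/-- The graph of the complex: its edges are the pairs of distinct vertices of a common face. -/
def graph (K : FaceSet V) : SimpleGraph V where
  Adj x y := x ≠ y ∧ ∃ F ∈ K, x ∈ F ∧ y ∈ F
  symm := ⟨fun _ _ h => ⟨h.1.symm, let ⟨F, hF, hx, hy⟩ := h.2; ⟨F, hF, hy, hx⟩⟩⟩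
  loopless := ⟨fun _ h => h.1 rfl⟩

/-- The link of the vertex `v`: the edges opposite to `v` in the faces incident to `v`. -/
def link (K : FaceSet V) (v : V) : SimpleGraph V where
  Adj x y := x ≠ y ∧ x ≠ v ∧ y ≠ v ∧ ∃ F ∈ K, v ∈ F ∧ x ∈ F ∧ y ∈ F
  symm := ⟨fun _ _ h => ⟨h.1.symm, h.2.2.1, h.2.1,
    let ⟨F, hF, hv, hx, hy⟩ := h.2.2.2; ⟨F, hF, hv, hy, hx⟩⟩⟩
  loopless := ⟨fun _ h => h.1 rfl⟩

/-- The complex triangulates a closed connected surface, so that its graph is a simple graph, its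
faces are triangles and two faces share at most one edge: the faces are three-element sets, the
graph is connected, and the link of every vertex is a cycle through all neighbours of that vertex
(a finite connected graph in which all vertices have degree two). -/
structure IsTriangulation (K : FaceSet V) : Prop where
  nonempty : K.Nonempty
  card_face : ∀ F ∈ K, F.card = 3
  connected : ∀ x y, IsVertex K x → IsVertex K y → (graph K).Reachable x y
  link_degree : ∀ v x, (graph K).Adj v x → ((link K v).neighborSet x).ncard = 2
  link_connected : ∀ v x y, (graph K).Adj v x → (graph K).Adj v y → (link K v).Reachable x y

/-- The Euler characteristic `#vertices - #edges + #faces`. -/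
def eulerChar (K : FaceSet V) : ℤ :=
  ((K.biUnion id).card : ℤ) - ((K.biUnion (Finset.powersetCard 2)).card : ℤ) + (K.card : ℤ)

/-- The Euler genus `2 - χ`. The sphere is the only closed connected surface for which it is `0`. -/
def eulerGenus (K : FaceSet V) : ℤ := 2 - eulerChar K

/-- The identification of `c` with `a`. -/
def merge (a c x : V) : V := if x = c then a else x

/-- The contraction of the edge `ac`: the faces containing `ac` disappear, and the vertex `c` is
identified with the vertex `a` in all the others. -/
def contract (K : FaceSet V) (a c : V) : FaceSet V :=
  (K.filter fun F => ¬ (a ∈ F ∧ c ∈ F)).image fun F => F.image (merge a c)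

/-- The contraction of the edge `ac`, carried out in the surface, leaves a simple graph: when `a`
and `c` are identified, two distinct edges `xy` and `x'y'` become parallel only if they are the two
edges other than `ac` of a face containing `ac` (one of these two is removed by the contraction). -/
def ContractsToSimpleGraph (K : FaceSet V) (a c : V) : Prop :=
  ∀ x y x' y' : V, (graph K).Adj x y → (graph K).Adj x' y' →
    s(x, y) ≠ s(a, c) → s(x', y') ≠ s(a, c) → s(x, y) ≠ s(x', y') →
    s(merge a c x, merge a c y) = s(merge a c x', merge a c y') →
    ∃ F ∈ K, a ∈ F ∧ c ∈ F ∧ x ∈ F ∧ y ∈ F ∧ x' ∈ F ∧ y' ∈ F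

/-- The edge `ac` is contractible: its contraction yields another triangulation of the same surface.
Carried out in the surface, the contraction leaves the surface unchanged; `ContractsToSimpleGraph`
says that no parallel edges are left over, so that the complex `contract K a c` is the contracted
embedded graph and not a further quotient of it. -/
structure IsContractible (K : FaceSet V) (a c : V) : Prop where
  edge : (graph K).Adj a c
  simple : ContractsToSimpleGraph K a c
  triangulation : IsTriangulation (contract K a c)

/-- An irreducible triangulation: one without contractible edges. -/
structure IsIrreducible (K : FaceSet V) : Prop where
  triangulation : IsTriangulation K
  not_contractible : ∀ x y, (graph K).Adj x y → ¬ IsContractible K x y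

/-- The vertices `w 0, w 1, w 2` form a 3-cycle. -/
def IsThreeCycle (K : FaceSet V) (w : Fin 3 → V) : Prop :=
  ∀ i j, i ≠ j → (graph K).Adj (w i) (w j)

/-- `F` and `G` have an edge in common which is not an edge of the 3-cycle `w`. -/
def AdjacentOff (K : FaceSet V) (w : Fin 3 → V) (F G : Finset V) : Prop :=
  F ∈ K ∧ G ∈ K ∧ ∃ x y, x ≠ y ∧ x ∈ F ∧ y ∈ F ∧ x ∈ G ∧ y ∈ G ∧
    ¬ (x ∈ Set.range w ∧ y ∈ Set.range w)

/-- The 3-cycle `w` is nonseparating: its complement in the surface is connected, that is, one can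
pass from any face to any other by crossing edges that do not belong to the 3-cycle. -/
def IsNonseparating (K : FaceSet V) (w : Fin 3 → V) : Prop :=
  ∀ F ∈ K, ∀ G ∈ K, Relation.ReflTransGen (AdjacentOff K w) F G

/-- `side i F` tells on which of the two local sides of the 3-cycle `w` at the vertex `w i` a face
`F` incident to `w i` lies. Around `w i` one stays on the same side when an edge not belonging to
the 3-cycle is crossed, and changes sides when one of its two edges at `w i` is crossed. -/
structure IsSideLabelling (K : FaceSet V) (w : Fin 3 → V) (side : Fin 3 → Finset V → Bool) :
    Prop where
  same : ∀ i, ∀ F ∈ K, ∀ G ∈ K, ∀ x, x ∉ Set.range w →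
    w i ∈ F → w i ∈ G → x ∈ F → x ∈ G → side i F = side i G
  opposite : ∀ i j, i ≠ j → ∀ F ∈ K, ∀ G ∈ K, F ≠ G →
    w i ∈ F → w j ∈ F → w i ∈ G → w j ∈ G → side i F ≠ side i G

/-- The local sides fit together along the whole 3-cycle: it is two-sided. -/
def IsTwoSidedLabelling (K : FaceSet V) (w : Fin 3 → V) (side : Fin 3 → Finset V → Bool) : Prop :=
  IsSideLabelling K w side ∧
    ∀ i j, ∀ F ∈ K, w i ∈ F → w j ∈ F → side i F = side j F

/-- The local sides fit together along two edges of the 3-cycle and are exchanged along the third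
one: a neighbourhood of the 3-cycle is a Möbius band, it is one-sided. -/
def IsOneSidedLabelling (K : FaceSet V) (w : Fin 3 → V) (side : Fin 3 → Finset V → Bool) : Prop :=
  IsSideLabelling K w side ∧
    (∀ F ∈ K, w 0 ∈ F → w 1 ∈ F → side 0 F = side 1 F) ∧
    (∀ F ∈ K, w 1 ∈ F → w 2 ∈ F → side 1 F = side 2 F) ∧
    (∀ F ∈ K, w 2 ∈ F → w 0 ∈ F → side 2 F ≠ side 0 F)

end Triangulations

/-- Vertices after a cut/cap operation: an old vertex not on the 3-cycle, the two vertices `u i` and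
`v i` that come from the vertex `w i` of the 3-cycle, and the apex `t` of a hexagonal cap. -/
inductive CutVertex (V : Type*) where
  | old (x : V) : CutVertex V
  | u (i : Fin 3) : CutVertex V
  | v (i : Fin 3) : CutVertex V
  | t : CutVertex V
  deriving DecidableEq

section CutCap

variable {V : Type*} [DecidableEq V]

/-- The vertex of the cut surface at which the corner at `x` of the face `F` is found. -/
def liftVertex (w : Fin 3 → V) (side : Fin 3 → Finset V → Bool) (F : Finset V) (x : V) :
    CutVertex V :=
  if x = w 0 then (if side 0 F then CutVertex.u 0 else CutVertex.v 0)
  else if x = w 1 then (if side 1 F then CutVertex.u 1 else CutVertex.v 1)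
  else if x = w 2 then (if side 2 F then CutVertex.u 2 else CutVertex.v 2)
  else CutVertex.old x

/-- The faces of the surface with boundary obtained by cutting along the 3-cycle `w`. -/
def cut (K : FaceSet V) (w : Fin 3 → V) (side : Fin 3 → Finset V → Bool) :
    FaceSet (CutVertex V) :=
  K.image fun F => F.image (liftVertex w side F)

variable (V) in
/-- The two faces that cap the two boundary 3-cycles. -/
def handleCap : FaceSet (CutVertex V) :=
  {{.u 0, .u 1, .u 2}, {.v 0, .v 1, .v 2}}

variable (V) in
/-- The six faces that cap the boundary 6-cycle. -/
def crosscapCap : FaceSet (CutVertex V) :=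
  {{.t, .u 0, .u 1}, {.t, .u 1, .u 2}, {.t, .u 2, .v 0},
   {.t, .v 0, .v 1}, {.t, .v 1, .v 2}, {.t, .v 2, .u 0}}

/-- `K'` arises from `K` by the cut/cap operation along the 3-cycle `w`, and `cap` is the set of
added faces. -/
def IsCutCap (K : FaceSet V) (w : Fin 3 → V) (K' cap : FaceSet (CutVertex V)) : Prop :=
  ∃ side : Fin 3 → Finset V → Bool, K' = cut K w side ∪ cap ∧
    ((IsTwoSidedLabelling K w side ∧ cap = handleCap V) ∨
      (IsOneSidedLabelling K w side ∧ cap = crosscapCap V))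

/-- The vertices of the frame are those of the added faces. -/
def IsFrameVertex (cap : FaceSet (CutVertex V)) (x : CutVertex V) : Prop := IsVertex cap x

/-- The edges of the frame are those of the added faces. -/
def IsFrameEdge (cap : FaceSet (CutVertex V)) (x y : CutVertex V) : Prop := (graph cap).Adj x y

/-- `K''` is the triangulation obtained from `K'` by contracting one interior edge, an edge neither
end of which is a frame vertex. -/
def InteriorContraction (cap K' K'' : FaceSet (CutVertex V)) : Prop :=
  ∃ a c, ¬ IsFrameVertex cap a ∧ ¬ IsFrameVertex cap c ∧ IsContractible K' a c ∧
    K'' = contract K' a c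

/-- The edge `xy` is on a path of length at most 3 connecting `u i` and `v i`. -/
def EdgeOnShortPath (K : FaceSet (CutVertex V)) (i : Fin 3) (x y : CutVertex V) : Prop :=
  ∃ p : (graph K).Walk (.u i) (.v i), p.IsPath ∧ p.length ≤ 3 ∧ s(x, y) ∈ p.edges

/-- The vertex `x` is on a path of length at most 3 connecting `u i` and `v i`. -/
def VertexOnShortPath (K : FaceSet (CutVertex V)) (i : Fin 3) (x : CutVertex V) : Prop :=
  ∃ p : (graph K).Walk (.u i) (.v i), p.IsPath ∧ p.length ≤ 3 ∧ x ∈ p.support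

end CutCap

end SurfTri

namespace SurfTri

/-! ### Cycles, links and nonfacial 3-cycles. -/

section General

variable {V : Type*}

/-! The central notion is that of a nonfacial 3-cycle. An edge on one is not contractible, since its
contraction leaves parallel edges. Conversely, an edge on none is contractible unless the surface is
the sphere: the links after contraction are glued from the old ones, and they can fail to be cycles
only if the triangulation is the boundary of a tetrahedron. So every edge of `T` is on a nonfacial
3-cycle (`IsIrreducible.exists_isNonfacial`).

Take an edge of `T'` with an end off the frame, and a nonfacial 3-cycle of `T` through its
projection. Either this 3-cycle lifts to a nonfacial 3-cycle of `T'`, or the cut breaks it open into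
a path of length 3 between the two copies of some `w i` (`IsCapping.exists_third_lift`). This gives
the conclusion for `T'`, with nonfacial 3-cycles as the reason for noncontractibility
(`IsCapping.isCovered`).

It remains to follow these certificates through the contraction of an interior edge `ac`
(`IsCovered.contract`). The frame is fixed and short paths do not get longer. A nonfacial 3-cycle
`C` could become a face only if, up to exchanging `a` and `c`, `C = apq` and `cpq` is a face; then
the link of `c` is the triangle `apq`. To exclude this the invariant requires `C` to be tight: every
edge with an end in a set of interior vertices cut off by `C` is on a nonfacial 3-cycle. For the set
`{c}` this contradicts the contractibility of `ac`. Tightness holds in `T'` because 3-cycles at such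
a set cannot be broken: `C` never contains both copies of a `w i` (`IsCapping.isTightAround`). It
persists because no edge at such a set can be contracted (`IsTightAround.contract`). Only links of
nonframe vertices are needed, hence `IsSurfaceOff`. -/

theorem mem_of_reachable_of_closed {G : SimpleGraph V} {S : Set V}
    (hS : ∀ x ∈ S, ∀ y, G.Adj x y → y ∈ S) {x y : V} (h : G.Reachable x y) (hx : x ∈ S) : y ∈ S := by
  obtain ⟨p⟩ := h
  induction p with
  | nil => exact hx
  | cons hadj _ ih => exact ih (hS _ hx _ hadj)

/-- In a connected graph with all degrees two, the vertices other than `a` form a connected set. -/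
theorem mem_of_closed_avoiding {G : SimpleGraph V} {N : Set V}
    (hN : ∀ x y, G.Adj x y → x ∈ N) (hdeg : ∀ x ∈ N, (G.neighborSet x).ncard = 2)
    (hfin : N.Finite) (hconn : ∀ x ∈ N, ∀ y ∈ N, G.Reachable x y) {a : V} (ha : a ∈ N) {S : Set V} (haS : a ∉ S)
    {s : V} (hs : s ∈ S) (hsN : s ∈ N) (hS : ∀ x ∈ S, ∀ y, G.Adj x y → y ≠ a → y ∈ S) :
    ∀ y ∈ N, y ≠ a → y ∈ S := by
  have : Finite N := hfin
  -- `V` may be infinite, so the graph is restricted to the finite set `N`. A finite graph with all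
  -- degrees two has no bridge, which gives `hdel`.
  have hcyc : (G.comap (Subtype.val : N → V)).IsCycles := by
    rintro x -
    rw [← Set.ncard_image_of_injective _ Subtype.val_injective, ← hdeg x x.2]
    congr 1
    ext y
    constructor
    · rintro ⟨z, hz, rfl⟩
      exact hz
    · intro hy
      exact ⟨⟨y, hN y x hy.symm⟩, hy, rfl⟩
  have hdel : ∀ b, G.Adj a b → (G \ SimpleGraph.fromEdgeSet {s(a, b)}).Reachable b a := by
    intro b hab
    have h := hcyc.reachable_deleteEdges (v := ⟨a, ha⟩) (w := ⟨b, hN b a hab.symm⟩) hab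
    refine (h.map (G' := G \ SimpleGraph.fromEdgeSet {s(a, b)}) ⟨Subtype.val, ?_⟩).symm
    intro x y hxy
    have h' : G.Adj x y ∧ ((x : V) = a → ¬ (y : V) = b) ∧ ((x : V) = b → ¬ (y : V) = a) := by
      simpa [Subtype.ext_iff] using hxy
    have goal : G.Adj x y ∧ ((x : V) = a ∧ (y : V) = b ∨ (x : V) = b ∧ (y : V) = a →
        (x : V) = y) := ⟨h'.1, by grind⟩
    simpa using goal
  obtain ⟨b, d, hbd, hnb⟩ := Set.ncard_eq_two.1 (hdeg a ha)
  have hab : G.Adj a b := by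
    have : b ∈ G.neighborSet a := by rw [hnb]; simp
    exact this
  have had : G.Adj a d := by
    have : d ∈ G.neighborSet a := by rw [hnb]; simp
    exact this
  -- If `S` contained `b` but not `d`, it would be closed in the graph without the edge `ab`,
  -- although `b` still reaches `a` there.
  have key : ∀ b d : V, G.neighborSet a = {b, d} → G.Adj a b → b ∈ S → d ∈ S := by
    intro b d hnb hab hb
    by_contra hd
    refine haS (mem_of_reachable_of_closed (S := S) ?_ (hdel b hab) hb)
    intro x hx y hxy
    rw [SimpleGraph.sdiff_adj] at hxy
    by_cases hy : y = a
    · subst hy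
      have : x ∈ G.neighborSet y := hxy.1.symm
      rw [hnb] at this
      rcases this with rfl | rfl
      · exact absurd (by simp [Sym2.eq_swap, hxy.1.ne]) hxy.2
      · exact absurd hx hd
    · exact hS x hx y hxy.1 hy
  -- So `S` contains both neighbours of `a` or neither. In the first case `insert a S` is closed,
  -- hence everything; in the second `S` is closed and would contain `a`.
  by_cases h : b ∈ S ∨ d ∈ S
  · have hb : b ∈ S := h.elim id (key d b (by rw [hnb, Set.pair_comm]) had)
    have hd : d ∈ S := key b d hnb hab hb
    intro y hy hya
    have : y ∈ insert a S := by
      refine mem_of_reachable_of_closed (S := insert a S) ?_ (hconn s hsN y hy) (Or.inr hs)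
      rintro x (rfl | hx) z hxz
      · have : z ∈ G.neighborSet x := hxz
        rw [hnb] at this
        rcases this with rfl | rfl
        · exact Or.inr hb
        · exact Or.inr hd
      · by_cases hz : z = a
        · exact Or.inl hz
        · exact Or.inr (hS x hx z hxz hz)
    exact this.resolve_left hya
  · push Not at h
    refine absurd (mem_of_reachable_of_closed (S := S) ?_ (hconn s hsN a ha) hs) haS
    intro x hx y hxy
    refine hS x hx y hxy ?_
    rintro rfl
    have : x ∈ G.neighborSet y := hxy.symm
    rw [hnb] at this
    rcases this with rfl | rfl
    · exact h.1 hx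
    · exact h.2 hx

/-- The faces are triangles, and the link of a vertex is a cycle unless the vertex satisfies `B`. -/
structure IsSurfaceOff (K : FaceSet V) (B : V → Prop) : Prop where
  card_face : ∀ F ∈ K, F.card = 3
  link_degree : ∀ v x, ¬ B v → (graph K).Adj v x → ((link K v).neighborSet x).ncard = 2
  link_connected : ∀ v x y, ¬ B v → (graph K).Adj v x → (graph K).Adj v y →
    (link K v).Reachable x y

theorem IsTriangulation.isSurfaceOff {K : FaceSet V} (h : IsTriangulation K) (B : V → Prop) :
    IsSurfaceOff K B :=
  ⟨h.card_face, fun v x _ => h.link_degree v x, fun v x y _ => h.link_connected v x y⟩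

theorem adj_of_face {K : FaceSet V} {F : Finset V} (hF : F ∈ K) {x y : V} (hx : x ∈ F)
    (hy : y ∈ F) (h : x ≠ y) : (graph K).Adj x y := ⟨h, F, hF, hx, hy⟩

theorem adj_of_link_adj {K : FaceSet V} {v x y : V} (h : (link K v).Adj x y) :
    (graph K).Adj v x := by
  obtain ⟨-, h2, -, F, hF, hv, hx, -⟩ := h
  exact ⟨h2.symm, F, hF, hv, hx⟩

theorem adj_of_link_adj' {K : FaceSet V} {v x y : V} (h : (link K v).Adj x y) :
    (graph K).Adj x y := by
  obtain ⟨h1, h2, -, F, hF, hv, hx, hy⟩ := h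
  exact ⟨h1, F, hF, hx, hy⟩

theorem eq_or_eq_of_ncard_two {s : Set V} (hs : s.ncard = 2) {x y z : V} (hx : x ∈ s) (hy : y ∈ s)
    (hxy : x ≠ y) (hz : z ∈ s) : z = x ∨ z = y := by
  obtain ⟨p, q, hpq, rfl⟩ := Set.ncard_eq_two.1 hs
  simp only [Set.mem_insert_iff, Set.mem_singleton_iff] at hx hy hz
  grind

theorem finite_neighbors (K : FaceSet V) (v : V) : {x | (graph K).Adj v x}.Finite := by
  classical
  refine (K.biUnion id).finite_toSet.subset ?_
  rintro x ⟨-, F, hF, -, hx⟩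
  simp only [Finset.coe_biUnion, Set.mem_iUnion]
  exact ⟨F, hF, hx⟩

/-- A connected link has no vertices beyond a triangle contained in it. -/
theorem IsSurfaceOff.mem_of_link_triangle {K : FaceSet V} {B : V → Prop} (hK : IsSurfaceOff K B)
    {v x y z : V} (hv : ¬ B v) (hxy : (link K v).Adj x y) (hyz : (link K v).Adj y z)
    (hzx : (link K v).Adj z x) {s : V} (hs : (graph K).Adj v s) : s = x ∨ s = y ∨ s = z := by
  have : s ∈ ({x, y, z} : Set V) := by
    refine mem_of_reachable_of_closed (S := {x, y, z}) ?_
      (hK.link_connected v x s hv (adj_of_link_adj hxy) hs) (by simp)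
    have aux : ∀ p q r t, (link K v).Adj p q → (link K v).Adj p r → q ≠ r → (link K v).Adj p t →
        t = q ∨ t = r := fun p q r t hq hr hqr ht =>
      eq_or_eq_of_ncard_two (hK.link_degree v p hv (adj_of_link_adj hq)) hq hr hqr ht
    rintro p (rfl | rfl | rfl) t ht
    · rcases aux _ _ _ t hxy hzx.symm hyz.ne ht with rfl | rfl <;> simp
    · rcases aux _ _ _ t hxy.symm hyz hzx.ne' ht with rfl | rfl <;> simp
    · rcases aux _ _ _ t hzx hyz.symm hxy.ne ht with rfl | rfl <;> simp
  simpa using this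

/-- The link of `v` without its vertex `a` is connected. -/
theorem IsSurfaceOff.mem_of_link_closed {K : FaceSet V} {B : V → Prop} (hK : IsSurfaceOff K B)
    {v a : V} (hv : ¬ B v) (ha : (graph K).Adj v a) {S : Set V} (haS : a ∉ S) {s : V} (hs : s ∈ S)
    (hvs : (graph K).Adj v s) (hS : ∀ x ∈ S, ∀ y, (link K v).Adj x y → y ≠ a → y ∈ S) {y : V}
    (hy : (graph K).Adj v y) (hya : y ≠ a) : y ∈ S :=
  mem_of_closed_avoiding (N := {x | (graph K).Adj v x}) (fun _ _ h => adj_of_link_adj h)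
    (fun x hx => hK.link_degree v x hv hx) (finite_neighbors K v) (fun x hx y hy => hK.link_connected v x y hv hx hy)
    ha haS hs hvs hS y hy hya

variable [DecidableEq V]

theorem exists_third {F : Finset V} (hF : F.card = 3) {x y : V} (hx : x ∈ F) (hy : y ∈ F)
    (hxy : x ≠ y) : ∃ z, z ≠ x ∧ z ≠ y ∧ F = {x, y, z} := by
  have h1 : ({x, y} : Finset V) ⊆ F := by simp [Finset.insert_subset_iff, hx, hy]
  have h2 : (F \ {x, y}).card = 1 := by
    rw [Finset.card_sdiff_of_subset h1, hF, Finset.card_pair hxy]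
  obtain ⟨z, hz⟩ := Finset.card_eq_one.1 h2
  have hz' : z ∈ F \ {x, y} := by rw [hz]; simp
  simp only [Finset.mem_sdiff, Finset.mem_insert, Finset.mem_singleton, not_or] at hz'
  refine ⟨z, hz'.2.1, hz'.2.2, ?_⟩
  rw [← Finset.union_sdiff_of_subset h1, hz]
  ext; simp

theorem eq_triple {F : Finset V} (hF : F.card = 3) {x y z : V} (hx : x ∈ F) (hy : y ∈ F)
    (hz : z ∈ F) (hxy : x ≠ y) (hxz : x ≠ z) (hyz : y ≠ z) : F = {x, y, z} := by
  symm
  apply Finset.eq_of_subset_of_card_le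
  · simp [Finset.insert_subset_iff, hx, hy, hz]
  · rw [hF, Finset.card_eq_three.2 ⟨x, y, z, hxy, hxz, hyz, rfl⟩]

/-- `C` is the vertex set of a 3-cycle which is not the boundary of a face. -/
def IsNonfacial (K : FaceSet V) (C : Finset V) : Prop :=
  C.card = 3 ∧ C ∉ K ∧ ∀ x ∈ C, ∀ y ∈ C, x ≠ y → (graph K).Adj x y

/-- Every edge with an end in a region that avoids `B` and is separated from the remaining
vertices by `C` lies on a nonfacial 3-cycle. -/
def IsTightAround (K : FaceSet V) (B : V → Prop) (C : Finset V) : Prop :=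
  ∀ I : Set V, (∀ x ∈ I, ¬ B x) → (∀ x ∈ C, x ∉ I) →
    (∀ x ∈ I, ∀ y, (graph K).Adj x y → y ∈ I ∨ y ∈ C) →
    ∀ x ∈ I, ∀ y, (graph K).Adj x y → ∃ D, IsNonfacial K D ∧ x ∈ D ∧ y ∈ D

/-- The edge `ac` is on no 3-cycle other than the boundaries of faces. -/
structure IsFacialEdge (K : FaceSet V) (a c : V) : Prop where
  adj : (graph K).Adj a c
  face : ∀ z, (graph K).Adj a z → (graph K).Adj c z → ({a, c, z} : Finset V) ∈ K

theorem IsFacialEdge.symm {K : FaceSet V} {a c : V} (h : IsFacialEdge K a c) :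
    IsFacialEdge K c a :=
  ⟨h.adj.symm, fun z hc ha => by rw [Finset.insert_comm]; exact h.face z ha hc⟩

/-- For a common neighbour `z` the edges `az` and `cz` become parallel, which is allowed only if
they bound a face together with `ac`. -/
theorem IsContractible.isFacialEdge {K : FaceSet V} (hcard : ∀ F ∈ K, F.card = 3) {a c : V}
    (h : IsContractible K a c) : IsFacialEdge K a c := by
  refine ⟨h.edge, fun z ha hc => ?_⟩
  have hac := h.edge.ne
  obtain ⟨F, hF, haF, hcF, -, hzF, -⟩ := h.simple a z c z ha hc
    (by simp [hc.ne', ha.ne']) (by simp [hc.ne', ha.ne'])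
    (by simp [hac, ha.ne])
    (by simp [merge])
  rwa [← eq_triple (hcard F hF) haF hcF hzF hac ha.ne hc.ne]

theorem IsFacialEdge.not_mem {K : FaceSet V} {a c : V} (h : IsFacialEdge K a c) {C : Finset V}
    (hC : IsNonfacial K C) : ¬ (a ∈ C ∧ c ∈ C) := by
  rintro ⟨ha, hc⟩
  obtain ⟨z, hza, hzc, rfl⟩ := exists_third hC.1 ha hc h.adj.ne
  exact hC.2.1 (h.face z (hC.2.2 _ ha _ (by simp) hza.symm) (hC.2.2 _ hc _ (by simp) hzc.symm))

theorem not_isContractible_of_isNonfacial {K : FaceSet V} (hcard : ∀ F ∈ K, F.card = 3)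
    {C : Finset V} (hC : IsNonfacial K C) {a c : V} (ha : a ∈ C) (hc : c ∈ C) :
    ¬ IsContractible K a c :=
  fun h => (h.isFacialEdge hcard).not_mem hC ⟨ha, hc⟩

theorem link_adj_iff {K : FaceSet V} (hcard : ∀ F ∈ K, F.card = 3) {v x y : V} :
    (link K v).Adj x y ↔ x ≠ y ∧ x ≠ v ∧ y ≠ v ∧ ({v, x, y} : Finset V) ∈ K := by
  constructor
  · rintro ⟨h1, h2, h3, F, hF, hv, hx, hy⟩
    refine ⟨h1, h2, h3, ?_⟩
    rwa [← eq_triple (hcard F hF) hv hx hy h2.symm h3.symm h1]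
  · rintro ⟨h1, h2, h3, h⟩
    exact ⟨h1, h2, h3, _, h, by simp, by simp, by simp⟩

theorem link_of_mem {K : FaceSet V} {v x y : V} (h : ({v, x, y} : Finset V) ∈ K)
    (h1 : x ≠ y) (h2 : x ≠ v) (h3 : y ≠ v) : (link K v).Adj x y :=
  ⟨h1, h2, h3, _, h, by simp, by simp, by simp⟩

/-- An edge at `v` is in a face that avoids a given further vertex. -/
theorem IsSurfaceOff.exists_face_avoiding {K : FaceSet V} {B : V → Prop} (hK : IsSurfaceOff K B)
    {v x : V} (hv : ¬ B v) (hx : (graph K).Adj v x) (c : V) :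
    ∃ y, y ≠ c ∧ (link K v).Adj x y := by
  obtain ⟨p, q, hpq, h⟩ := Set.ncard_eq_two.1 (hK.link_degree v x hv hx)
  have hp : (link K v).Adj x p := by
    have : p ∈ (link K v).neighborSet x := by rw [h]; simp
    exact this
  have hq : (link K v).Adj x q := by
    have : q ∈ (link K v).neighborSet x := by rw [h]; simp
    exact this
  by_cases hpc : p = c
  · exact ⟨q, fun h => hpq (hpc.trans h.symm), hq⟩
  · exact ⟨p, hpc, hp⟩

end General

/-! ### Edges under contraction. -/

section Contraction

variable {V : Type*} [DecidableEq V] {K : FaceSet V} {B : V → Prop} {a c : V}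

theorem merge_self_right : merge a c c = a := by simp [merge]

theorem merge_of_ne {x : V} (h : x ≠ c) : merge a c x = x := by simp [merge, h]

theorem merge_eq_merge {x y : V} (h : merge a c x = merge a c y) :
    x = y ∨ (x = a ∧ y = c) ∨ (x = c ∧ y = a) := by
  unfold merge at h; grind

theorem eq_of_merge_eq {x y : V} (h : merge a c x = y) (hy : y ≠ a) : x = y := by
  unfold merge at h; grind

theorem merge_injOn {s : Set V} (hs : ¬ (a ∈ s ∧ c ∈ s)) : Set.InjOn (merge a c) s := by
  intro x hx y hy h
  rcases merge_eq_merge h with h | ⟨rfl, rfl⟩ | ⟨rfl, rfl⟩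
  · exact h
  · exact absurd ⟨hx, hy⟩ hs
  · exact absurd ⟨hy, hx⟩ hs

theorem mem_contract {F : Finset V} :
    F ∈ contract K a c ↔ ∃ G ∈ K, ¬ (a ∈ G ∧ c ∈ G) ∧ G.image (merge a c) = F := by
  simp [contract, and_assoc]

theorem exists_adj_of_contract_adj {x y : V} (h : (graph (contract K a c)).Adj x y) :
    ∃ x' y', (graph K).Adj x' y' ∧ merge a c x' = x ∧ merge a c y' = y := by
  obtain ⟨hxy, F, hF, hx, hy⟩ := h
  obtain ⟨G, hG, -, rfl⟩ := mem_contract.1 hF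
  obtain ⟨x', hx', rfl⟩ := Finset.mem_image.1 hx
  obtain ⟨y', hy', rfl⟩ := Finset.mem_image.1 hy
  exact ⟨x', y', ⟨fun h => hxy (by rw [h]), G, hG, hx', hy'⟩, rfl, rfl⟩

/-- An edge of a vanishing face, other than `ac`, ends in `a` or `c`. The link there is a cycle, so
the edge has a second face, and this one survives. -/
theorem exists_face_not_both (hK : IsSurfaceOff K B) (ha : ¬ B a) (hc : ¬ B c) (hac : a ≠ c) {x y : V}
    (h : (graph K).Adj x y) (hne : merge a c x ≠ merge a c y) :
    ∃ G ∈ K, ¬ (a ∈ G ∧ c ∈ G) ∧ x ∈ G ∧ y ∈ G := by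
  have aux : ∀ p q z, ¬ B p → (graph K).Adj p z → z ≠ q → p ≠ q →
      ∃ G ∈ K, ¬ (p ∈ G ∧ q ∈ G) ∧ p ∈ G ∧ z ∈ G := by
    intro p q z hp hz hzq hpq
    obtain ⟨e, he, h⟩ := hK.exists_face_avoiding hp hz q
    have h' := (link_adj_iff hK.card_face).1 h
    refine ⟨_, h'.2.2.2, ?_, by simp, by simp⟩
    simp [he.symm, hpq.symm, hzq.symm]
  obtain ⟨hxy, F, hF, hx, hy⟩ := h
  by_cases hboth : a ∈ F ∧ c ∈ F
  swap
  · exact ⟨F, hF, hboth, hx, hy⟩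
  have hxyac : x = a ∨ x = c ∨ y = a ∨ y = c := by
    by_contra! hcon
    obtain ⟨z, h1, h2, rfl⟩ := exists_third (hK.card_face F hF) hboth.1 hboth.2 hac
    simp only [Finset.mem_insert, Finset.mem_singleton] at hx hy
    grind
  have hne1 : ¬ (x = a ∧ y = c) := by rintro ⟨rfl, rfl⟩; simp [merge] at hne
  have hne2 : ¬ (x = c ∧ y = a) := by rintro ⟨rfl, rfl⟩; simp [merge] at hne
  have hadj : (graph K).Adj x y := adj_of_face hF hx hy hxy
  rcases hxyac with rfl | rfl | rfl | rfl
  · exact aux x c y ha hadj (fun h => hne1 ⟨rfl, h⟩) hac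
  · obtain ⟨G, h1, h2, h3, h4⟩ := aux x a y hc hadj (fun h => hne2 ⟨rfl, h⟩) hac.symm
    exact ⟨G, h1, fun h => h2 h.symm, h3, h4⟩
  · obtain ⟨G, h1, h2, h3, h4⟩ := aux y c x ha hadj.symm (fun h => hne2 ⟨h, rfl⟩) hac
    exact ⟨G, h1, h2, h4, h3⟩
  · obtain ⟨G, h1, h2, h3, h4⟩ := aux y a x hc hadj.symm (fun h => hne1 ⟨h, rfl⟩) hac.symm
    exact ⟨G, h1, fun h => h2 h.symm, h4, h3⟩

theorem contract_adj (hK : IsSurfaceOff K B) (ha : ¬ B a) (hc : ¬ B c) (hac : a ≠ c) {x y : V}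
    (h : (graph K).Adj x y) (hne : merge a c x ≠ merge a c y) :
    (graph (contract K a c)).Adj (merge a c x) (merge a c y) := by
  obtain ⟨G, hG, hn, hx, hy⟩ := exists_face_not_both hK ha hc hac h hne
  exact ⟨hne, _, mem_contract.2 ⟨G, hG, hn, rfl⟩, Finset.mem_image_of_mem _ hx,
    Finset.mem_image_of_mem _ hy⟩

end Contraction

/-! ### Tight nonfacial 3-cycles under contraction. -/

section ContractionStep

variable {V : Type*} [DecidableEq V] {K : FaceSet V} {B : V → Prop} {a c : V}

theorem merge_frame (hc : ¬ B c) {x : V} (hx : B x) : merge a c x = x :=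
  merge_of_ne fun h => hc (h ▸ hx)

theorem not_frame_of_merge (hc : ¬ B c) {x : V} (hx : ¬ B (merge a c x)) : ¬ B x :=
  fun h => hx (by rwa [merge_frame hc h])

/-- Otherwise `a` and `c` are not both in `F ∪ C`, so `merge a c` is injective there and `F = C`,
although `C` is not a face. -/
theorem IsFacialEdge.exists_image_eq (hac : IsFacialEdge K a c) {C : Finset V}
    (hC : IsNonfacial K C) {F : Finset V} (hF : F ∈ K) (hn : ¬ (a ∈ F ∧ c ∈ F))
    (h : F.image (merge a c) = C.image (merge a c)) :
    (a ∈ C ∧ c ∈ F) ∨ (c ∈ C ∧ a ∈ F) := by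
  by_contra hcon
  push Not at hcon
  have hCn := hac.not_mem hC
  refine hC.2.1 ?_
  have hinj : Set.InjOn (merge a c) ((F : Set V) ∪ C) := by
    apply merge_injOn
    rintro ⟨h1 | h1, h2 | h2⟩
    · exact hn ⟨h1, h2⟩
    · exact hcon.2 h2 h1
    · exact hcon.1 h1 h2
    · exact hCn ⟨h1, h2⟩
  have : F = C := by
    apply Finset.coe_injective
    refine (hinj.image_eq_image_iff Set.subset_union_left Set.subset_union_right).1 ?_
    simpa using congrArg (fun s : Finset V => (s : Set V)) h
  exact this ▸ hF

/-- If a nonfacial 3-cycle through `a` becomes a face when `ac` is contracted, then it surrounds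
the vertex `c`. -/
theorem IsFacialEdge.neighbor_mem (hK : IsSurfaceOff K B) (hc : ¬ B c) (hac : IsFacialEdge K a c)
    {C : Finset V} (hC : IsNonfacial K C) {F : Finset V} (hF : F ∈ K)
    (himg : F.image (merge a c) = C.image (merge a c)) (haC : a ∈ C) (hcF : c ∈ F)
    (haF : a ∉ F) {s : V} (hs : (graph K).Adj c s) : s ∈ C := by
  have hCn := hac.not_mem hC
  have hcC : c ∉ C := fun h => hCn ⟨haC, h⟩
  have hmem : ∀ p ∈ F, p ≠ c → p ∈ C := by
    intro p hp hpc
    have : merge a c p ∈ C.image (merge a c) := himg ▸ Finset.mem_image_of_mem _ hp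
    obtain ⟨q, hq, hqp⟩ := Finset.mem_image.1 this
    rcases merge_eq_merge hqp with h | ⟨-, h⟩ | ⟨h, -⟩
    · exact h ▸ hq
    · exact absurd h hpc
    · exact absurd (h ▸ hq) hcC
  have hFc := hK.card_face F hF
  obtain ⟨p, hp, hpc⟩ := Finset.exists_mem_ne (by omega : 1 < F.card) c
  obtain ⟨q, hqc, hqp, hFe⟩ := exists_third hFc hcF hp hpc.symm
  have hq : q ∈ F := by rw [hFe]; simp
  have hpa : p ≠ a := fun h => haF (h ▸ hp)
  have hqa : q ≠ a := fun h => haF (h ▸ hq)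
  have hpC := hmem p hp hpc
  have hqC := hmem q hq hqc
  -- Now `F = cpq` and `C = apq`. As `p` and `q` are common neighbours of `a` and `c`, also `acp`
  -- and `acq` are faces, so the link of `c` contains the triangle `apq` and is equal to it.
  have h1 := hac.face p (hC.2.2 a haC p hpC hpa.symm) (adj_of_face hF hcF hp hpc.symm)
  have h2 := hac.face q (hC.2.2 a haC q hqC hqa.symm) (adj_of_face hF hcF hq hqc.symm)
  rw [Finset.insert_comm] at h1 h2
  have l1 := link_of_mem h1 hpa.symm hac.adj.ne hpc
  have l2 := link_of_mem h2 hqa.symm hac.adj.ne hqc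
  have l3 := link_of_mem (hFe ▸ hF) hqp.symm hpc hqc
  rcases hK.mem_of_link_triangle hc l1 l3 l2.symm hs with rfl | rfl | rfl
  · exact haC
  · exact hpC
  · exact hqC

/-- Tightness for the region `{c}` puts `ca` on a nonfacial 3-cycle. -/
theorem IsTightAround.false_of_surrounded (hac : IsFacialEdge K a c) (hc : ¬ B c) {C : Finset V}
    (hT : IsTightAround K B C) (hcC : c ∉ C) (h : ∀ s, (graph K).Adj c s → s ∈ C) : False := by
  obtain ⟨D, hD, h1, h2⟩ := hT {c} (by rintro x rfl; exact hc) (by rintro x hx rfl; exact hcC hx)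
    (by rintro x rfl y hy; exact Or.inr (h y hy)) c rfl a hac.adj.symm
  exact hac.not_mem hD ⟨h2, h1⟩

theorem IsNonfacial.image_merge (hK : IsSurfaceOff K B) (ha : ¬ B a) (hc : ¬ B c)
    (hac : IsFacialEdge K a c) {C : Finset V} (hC : IsNonfacial K C)
    (hface : C.image (merge a c) ∉ contract K a c) :
    IsNonfacial (contract K a c) (C.image (merge a c)) := by
  have hinj : Set.InjOn (merge a c) (C : Set V) := merge_injOn (hac.not_mem hC)
  refine ⟨by rw [Finset.card_image_of_injOn hinj, hC.1], hface, ?_⟩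
  intro x hx y hy hxy
  obtain ⟨x, hx', rfl⟩ := Finset.mem_image.1 hx
  obtain ⟨y, hy', rfl⟩ := Finset.mem_image.1 hy
  exact contract_adj hK ha hc hac.adj.ne (hC.2.2 x hx' y hy' fun h => hxy (by rw [h])) hxy

theorem IsNonfacial.contract (hK : IsSurfaceOff K B) (ha : ¬ B a) (hc : ¬ B c)
    (hac : IsFacialEdge K a c) {C : Finset V} (hC : IsNonfacial K C) (hT : IsTightAround K B C) :
    IsNonfacial (contract K a c) (C.image (merge a c)) := by
  refine hC.image_merge hK ha hc hac ?_
  intro hmem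
  obtain ⟨F, hF, hn, himg⟩ := mem_contract.1 hmem
  have hCn := hac.not_mem hC
  rcases hac.exists_image_eq hC hF hn himg with ⟨h1, h2⟩ | ⟨h1, h2⟩
  · exact hT.false_of_surrounded hac hc (fun h => hCn ⟨h1, h⟩) fun s hs =>
      hac.neighbor_mem hK hc hC hF himg h1 h2 (fun h => hn ⟨h, h2⟩) hs
  -- The roles of `a` and `c` can be exchanged: the two ways of merging differ only in the name of
  -- the merged vertex.
  · have hswap : ∀ G : Finset V, G.image (merge c a) = (G.image (merge a c)).image (merge c a) := by
      intro G
      rw [Finset.image_image]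
      congr 1
      ext x
      simp only [Function.comp, merge]
      grind
    exact hT.false_of_surrounded hac.symm ha (fun h => hCn ⟨h, h1⟩) fun s hs =>
      hac.symm.neighbor_mem hK ha hC hF (by rw [hswap F, himg, ← hswap]) h1 h2
        (fun h => hn ⟨h2, h⟩) hs

/-- If one neighbour of `c` lies in a region that is separated from the remaining vertices by `C`
and `c`, where `a ∈ C`, then all neighbours of `c` lie in the region or in `C`. -/
theorem IsFacialEdge.neighbor_mem_region (hK : IsSurfaceOff K B) (hc : ¬ B c)
    (hac : IsFacialEdge K a c) {C : Finset V} (hC : IsNonfacial K C) (haC : a ∈ C)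
    {I : Set V} (hIC : ∀ x ∈ C, x ∉ I)
    (hI : ∀ x ∈ I, ∀ y, (graph K).Adj x y → y ∈ I ∨ y ∈ C ∨ y = c)
    {s : V} (hsI : s ∈ I) (hs : (graph K).Adj c s) {y : V} (hy : (graph K).Adj c y) :
    y ∈ I ∨ y ∈ C := by
  by_cases hya : y = a
  · exact Or.inr (hya ▸ haC)
  -- Walk along the link of `c` without `a`, starting in `I`. At a vertex `x` of `C` the face `acx`
  -- makes `a` one link neighbour of `x`, and the other one is the vertex of `I` from which `x` was
  -- reached. So the walk never leaves `I` and `C`.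
  let S : Set V := {x | x ∈ I ∨ (x ∈ C ∧ x ≠ a ∧ ∃ t ∈ I, (link K c).Adj x t)}
  have : y ∈ S := by
    refine hK.mem_of_link_closed (S := S) hc hac.adj.symm ?_ (Or.inl hsI) hs ?_ hy hya
    · rintro (h | h)
      · exact hIC a haC h
      · exact h.2.1 rfl
    · rintro x (hx | ⟨hxC, hxa, t, ht, hxt⟩) z hxz hza
      · rcases hI x hx z (adj_of_link_adj' hxz) with h | h | h
        · exact Or.inl h
        · exact Or.inr ⟨h, hza, x, hx, hxz.symm⟩
        · exact absurd h hxz.2.2.1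
      · left
        have hax := hac.face x (hC.2.2 a haC x hxC hxa.symm) (adj_of_link_adj hxz)
        rw [Finset.insert_comm] at hax
        have hl := link_of_mem hax hxa.symm hac.adj.ne hxz.2.1
        rcases eq_or_eq_of_ncard_two (hK.link_degree c x hc (adj_of_link_adj hxz)) hl.symm hxt
          (fun h => hIC a haC (h ▸ ht)) hxz with h | h
        · exact absurd h hza
        · exact h ▸ ht
  rcases this with h | h
  · exact Or.inl h
  · exact Or.inr h.1

/-- If an edge led from `I` to `c` outside `C`, then `insert c I` would itself be cut off by `C`,
and tightness would put `ca` on a nonfacial 3-cycle. -/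
theorem IsTightAround.closed_of_mem (hK : IsSurfaceOff K B) (hc : ¬ B c)
    (hac : IsFacialEdge K a c) {C : Finset V} (hC : IsNonfacial K C) (hT : IsTightAround K B C)
    (haC : a ∈ C) {I : Set V} (hIB : ∀ x ∈ I, ¬ B x) (hIC : ∀ x ∈ C, x ∉ I)
    (hI : ∀ x ∈ I, ∀ y, (graph K).Adj x y → y ∈ I ∨ y ∈ C ∨ y = c) (hcI : c ∉ I) :
    ∀ x ∈ I, ∀ y, (graph K).Adj x y → y ∈ I ∨ y ∈ C := by
  intro x hx y hxy
  by_contra hcon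
  have hyc : y = c := by
    rcases hI x hx y hxy with h | h | h
    · exact absurd (Or.inl h) hcon
    · exact absurd (Or.inr h) hcon
    · exact h
  subst hyc
  have hyC : y ∉ C := fun h => hcon (Or.inr h)
  obtain ⟨D, hD, h1, h2⟩ := hT (insert y I)
    (by rintro z (rfl | hz); exacts [hc, hIB z hz])
    (by
      rintro z hz (rfl | hz')
      exacts [hyC hz, hIC z hz hz'])
    (by
      rintro z (rfl | hz) t hzt
      · rcases hac.neighbor_mem_region hK hc hC haC hIC hI hx hxy.symm hzt with h | h
        · exact Or.inl (Or.inr h)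
        · exact Or.inr h
      · rcases hI z hz t hzt with h | h | h
        · exact Or.inl (Or.inr h)
        · exact Or.inr h
        · exact Or.inl (Or.inl h))
    y (Or.inl rfl) a hac.adj.symm
  exact hac.not_mem hD ⟨h2, h1⟩

theorem IsTightAround.contract (hK : IsSurfaceOff K B) (ha : ¬ B a) (hc : ¬ B c)
    (hac : IsFacialEdge K a c) {C : Finset V} (hC : IsNonfacial K C) (hT : IsTightAround K B C) :
    IsTightAround (contract K a c) B (C.image (merge a c)) := by
  intro I hIB hIC hI
  have hCn := hac.not_mem hC
  -- The region is pulled back. If one end of `ac` is in `C`, the preimage could a priori also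
  -- border on the other end; `closed_of_mem` rules this out, so `C` cuts off `J`.
  set J : Set V := {x | merge a c x ∈ I} with hJ
  have hJB : ∀ x ∈ J, ¬ B x := fun x hx => not_frame_of_merge hc (hIB _ hx)
  have hJC : ∀ x ∈ C, x ∉ J := fun x hx => hIC _ (Finset.mem_image_of_mem _ hx)
  have hstep : ∀ x ∈ J, ∀ y, (graph K).Adj x y → y ∈ J ∨ ∃ k ∈ C, merge a c k = merge a c y := by
    intro x hx y hxy
    by_cases he : merge a c x = merge a c y
    · left
      change merge a c y ∈ I
      rw [← he]
      exact hx
    · rcases hI _ hx _ (contract_adj hK ha hc hac.adj.ne hxy he) with h | h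
      · exact Or.inl h
      · exact Or.inr (Finset.mem_image.1 h)
  have hacJ : a ∈ J ↔ c ∈ J := by simp [hJ, merge]
  have hclosed : ∀ x ∈ J, ∀ y, (graph K).Adj x y → y ∈ J ∨ y ∈ C := by
    by_cases haC : a ∈ C
    · refine hT.closed_of_mem hK hc hac hC haC hJB hJC ?_ (fun h => hJC a haC (hacJ.2 h))
      intro x hx y hxy
      rcases hstep x hx y hxy with h | ⟨k, hk, hky⟩
      · exact Or.inl h
      · rcases merge_eq_merge hky with rfl | ⟨-, h⟩ | ⟨rfl, rfl⟩
        · exact Or.inr (Or.inl hk)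
        · exact Or.inr (Or.inr h)
        · exact Or.inr (Or.inl haC)
    · by_cases hcC : c ∈ C
      · refine hT.closed_of_mem hK ha hac.symm hC hcC hJB hJC ?_ (fun h => hJC c hcC (hacJ.1 h))
        intro x hx y hxy
        rcases hstep x hx y hxy with h | ⟨k, hk, hky⟩
        · exact Or.inl h
        · rcases merge_eq_merge hky with rfl | ⟨-, rfl⟩ | ⟨rfl, h⟩
          · exact Or.inr (Or.inl hk)
          · exact Or.inr (Or.inl hcC)
          · exact Or.inr (Or.inr h)
      · intro x hx y hxy
        rcases hstep x hx y hxy with h | ⟨k, hk, hky⟩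
        · exact Or.inl h
        · rcases merge_eq_merge hky with rfl | ⟨rfl, -⟩ | ⟨rfl, -⟩
          · exact Or.inr hk
          · exact absurd hk haC
          · exact absurd hk hcC
  have htight := hT J hJB hJC hclosed
  have haJ : a ∉ J := by
    intro h
    obtain ⟨D, hD, h1, h2⟩ := htight a h c hac.adj
    exact hac.not_mem hD ⟨h1, h2⟩
  have hcJ : c ∉ J := fun h => haJ (hacJ.2 h)
  -- Since the contracted edge has no end in `J`, nothing in `J ∪ C` is identified. Faces and
  -- 3-cycles through a vertex of `J` stay in this set, so nonfacial ones remain nonfacial.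
  have hinj : Set.InjOn (merge a c) (J ∪ C) := by
    apply merge_injOn
    rintro ⟨h1 | h1, h2 | h2⟩
    exacts [haJ h1, haJ h1, hcJ h2, hCn ⟨h1, h2⟩]
  intro x hx y hxy
  obtain ⟨x, y, hxy', rfl, rfl⟩ := exists_adj_of_contract_adj hxy
  have hxJ : x ∈ J := hx
  obtain ⟨D, hD, hxD, hyD⟩ := htight x hxJ y hxy'
  refine ⟨D.image (merge a c), hD.image_merge hK ha hc hac ?_, Finset.mem_image_of_mem _ hxD,
    Finset.mem_image_of_mem _ hyD⟩
  intro hmem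
  obtain ⟨F, hF, hn, himg⟩ := mem_contract.1 hmem
  have hxF : x ∈ F := by
    have : merge a c x ∈ F.image (merge a c) := himg ▸ Finset.mem_image_of_mem _ hxD
    obtain ⟨q, hq, hqx⟩ := Finset.mem_image.1 this
    rcases merge_eq_merge hqx with rfl | ⟨-, rfl⟩ | ⟨-, rfl⟩
    exacts [hq, absurd hxJ hcJ, absurd hxJ haJ]
  have hsubF : (F : Set V) ⊆ J ∪ C := by
    intro z hz
    by_cases hzx : x = z
    · exact Or.inl (hzx ▸ hxJ)
    · exact hclosed x hxJ z (adj_of_face hF hxF hz hzx)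
  have hsubD : (D : Set V) ⊆ J ∪ C := by
    intro z hz
    by_cases hzx : x = z
    · exact Or.inl (hzx ▸ hxJ)
    · exact hclosed x hxJ z (hD.2.2 x hxD z hz hzx)
  have : F = D := by
    apply Finset.coe_injective
    refine (hinj.image_eq_image_iff hsubF hsubD).1 ?_
    simpa using congrArg (fun s : Finset V => (s : Set V)) himg
  exact hD.2.1 (this ▸ hF)

end ContractionStep

/-! ### Contractibility off the sphere. -/

section Irreducible

variable {V : Type*} [DecidableEq V] {K : FaceSet V} {a b c d : V}

theorem eulerGenus_tetrahedron {Q : Finset V} (hQ : Q.card = 4) :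
    eulerGenus (Q.powersetCard 3) = 0 := by
  have h1 : (Q.powersetCard 3).biUnion id = Q := by
    ext x
    simp only [Finset.mem_biUnion, Finset.mem_powersetCard, id]
    constructor
    · rintro ⟨F, hF, hx⟩
      exact hF.1 hx
    · intro hx
      obtain ⟨F, h1, h2, h3⟩ := Finset.exists_subsuperset_card_eq
        (Finset.singleton_subset_iff.2 hx) (n := 3) (by simp) (by omega)
      exact ⟨F, ⟨h2, h3⟩, Finset.singleton_subset_iff.1 h1⟩
  have h2 : (Q.powersetCard 3).biUnion (Finset.powersetCard 2) = Q.powersetCard 2 := by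
    ext E
    simp only [Finset.mem_biUnion, Finset.mem_powersetCard]
    constructor
    · rintro ⟨F, hF, hE⟩
      exact ⟨hE.1.trans hF.1, hE.2⟩
    · rintro ⟨hE, hE2⟩
      obtain ⟨F, h1, h2, h3⟩ := Finset.exists_subsuperset_card_eq hE (n := 3) (by omega) (by omega)
      exact ⟨F, ⟨h2, h3⟩, h1, hE2⟩
  rw [eulerGenus, eulerChar, h1, h2, Finset.card_powersetCard, Finset.card_powersetCard, hQ]
  norm_num [Nat.choose]

theorem card_four (hab : a ≠ b) (hac : a ≠ c) (had : a ≠ d) (hbc : b ≠ c) (hbd : b ≠ d)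
    (hcd : c ≠ d) : ({a, b, c, d} : Finset V).card = 4 := by
  rw [Finset.card_insert_of_notMem (by simp [hab, hac, had]),
    Finset.card_eq_three.2 ⟨b, c, d, hbc, hbd, hcd, rfl⟩]

/-- A triangulation that contains the boundary of a tetrahedron is the sphere. -/
theorem IsTriangulation.eulerGenus_eq_zero (hK : IsTriangulation K)
    (hab : a ≠ b) (hac : a ≠ c) (had : a ≠ d) (hbc : b ≠ c) (hbd : b ≠ d) (hcd : c ≠ d)
    (h1 : ({a, b, c} : Finset V) ∈ K) (h2 : ({a, b, d} : Finset V) ∈ K)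
    (h3 : ({a, c, d} : Finset V) ∈ K) (h4 : ({b, c, d} : Finset V) ∈ K) : eulerGenus K = 0 := by
  have hS := hK.isSurfaceOff (fun _ => False)
  have aux : ∀ p q r s : V, p ≠ q → p ≠ r → p ≠ s → q ≠ r → q ≠ s → r ≠ s →
      {p, q, r} ∈ K → {p, q, s} ∈ K → {p, r, s} ∈ K → ∀ t, (graph K).Adj p t →
      t = q ∨ t = r ∨ t = s := by
    intro p q r s hpq hpr hps hqr hqs hrs f1 f2 f3 t ht
    exact hS.mem_of_link_triangle (by simp) (link_of_mem f1 hqr hpq.symm hpr.symm)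
      (link_of_mem f3 hrs hpr.symm hps.symm) (link_of_mem f2 hqs hpq.symm hps.symm).symm ht
  have hva : IsVertex K a := ⟨_, h1, by simp⟩
  have hQ : ∀ x, IsVertex K x → x ∈ ({a, b, c, d} : Set V) := by
    intro x hx
    refine mem_of_reachable_of_closed (S := {a, b, c, d}) ?_ (hK.connected a x hva hx) (by simp)
    rintro p (rfl | rfl | rfl | rfl) t ht
    · rcases aux p b c d hab hac had hbc hbd hcd h1 h2 h3 t ht with rfl | rfl | rfl <;> simp
    · rw [Finset.insert_comm] at h1 h2
      rcases aux p a c d hab.symm hbc hbd hac had hcd h1 h2 h4 t ht with rfl | rfl | rfl <;> simp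
    · have e1 : ({p, a, b} : Finset V) ∈ K := by convert h1 using 1; ext; simp; tauto
      rw [Finset.insert_comm] at h3 h4
      rcases aux p a b d hac.symm hbc.symm hcd hab had hbd e1 h3 h4 t ht with
        rfl | rfl | rfl <;> simp
    · have e1 : ({p, a, b} : Finset V) ∈ K := by convert h2 using 1; ext; simp; tauto
      have e2 : ({p, a, c} : Finset V) ∈ K := by convert h3 using 1; ext; simp; tauto
      have e3 : ({p, b, c} : Finset V) ∈ K := by convert h4 using 1; ext; simp; tauto
      rcases aux p a b c had.symm hbd.symm hcd.symm hab hac hbc e1 e2 e3 t ht with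
        rfl | rfl | rfl <;> simp
  -- By `hQ` there are no further vertices, so each face is one of the four triples, all of which
  -- are faces.
  have hKeq : K = ({a, b, c, d} : Finset V).powersetCard 3 := by
    ext F
    rw [Finset.mem_powersetCard]
    constructor
    · intro hF
      refine ⟨fun x hx => ?_, hK.card_face F hF⟩
      simpa using hQ x ⟨F, hF, hx⟩
    · rintro ⟨hF, hF3⟩
      have hc4 := card_four hab hac had hbc hbd hcd
      obtain ⟨x, hx, hxF⟩ : ∃ x ∈ ({a, b, c, d} : Finset V), x ∉ F := by
        by_contra! hcon
        have := Finset.card_le_card (show ({a, b, c, d} : Finset V) ⊆ F from hcon)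
        omega
      have hFe : F = ({a, b, c, d} : Finset V).erase x := by
        apply Finset.eq_of_subset_of_card_le
        · intro y hy
          exact Finset.mem_erase.2 ⟨fun h => hxF (h ▸ hy), hF hy⟩
        · rw [Finset.card_erase_of_mem hx]
          omega
      simp only [Finset.mem_insert, Finset.mem_singleton] at hx
      rcases hx with rfl | rfl | rfl | rfl
      · convert h4 using 1; rw [hFe]; ext; simp; grind
      · convert h3 using 1; rw [hFe]; ext; simp; grind
      · convert h2 using 1; rw [hFe]; ext; simp; grind
      · convert h1 using 1; rw [hFe]; ext; simp; grind
  rw [hKeq]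
  exact eulerGenus_tetrahedron (card_four hab hac had hbc hbd hcd)

/-- Both sides collect the third vertices of the faces at the edge `vx`; link degrees thus need
checking at one end only. -/
theorem link_neighborSet_symm (v x : V) (hcard : ∀ F ∈ K, F.card = 3) :
    (link K v).neighborSet x = (link K x).neighborSet v := by
  ext y
  simp only [SimpleGraph.mem_neighborSet, link_adj_iff hcard]
  rw [Finset.insert_comm]
  tauto

/-- Together with the faces `acx` and `acy`, the two given faces bound a tetrahedron. -/
theorem IsFacialEdge.not_two_common (hK : IsTriangulation K) (hgenus : eulerGenus K ≠ 0)
    (hac : IsFacialEdge K a c) {x y : V} (h1 : {x, y, a} ∈ K) (h2 : {x, y, c} ∈ K) (hxy : x ≠ y)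
    (hxa : x ≠ a) (hxc : x ≠ c) (hya : y ≠ a) (hyc : y ≠ c) : False := by
  have f1 := hac.face x (adj_of_face h1 (by simp) (by simp) hxa.symm)
    (adj_of_face h2 (by simp) (by simp) hxc.symm)
  have f2 := hac.face y (adj_of_face h1 (by simp) (by simp) hya.symm)
    (adj_of_face h2 (by simp) (by simp) hyc.symm)
  refine hgenus (hK.eulerGenus_eq_zero hxy hxa hxc hya hyc hac.adj.ne h1 h2 ?_ ?_)
  · convert f1 using 1; ext; simp; tauto
  · convert f2 using 1; ext; simp; tauto

/-- Edges that become parallel are `az` and `cz` for a common neighbour `z`, and then `acz` is a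
face. -/
theorem IsFacialEdge.simple (hac : IsFacialEdge K a c) :
    ContractsToSimpleGraph K a c := by
  have key : ∀ z, (graph K).Adj a z → (graph K).Adj c z →
      ∃ F ∈ K, a ∈ F ∧ c ∈ F ∧ z ∈ F := fun z h1 h2 =>
    ⟨_, hac.face z h1 h2, by simp, by simp, by simp⟩
  intro x y x' y' h h' hne hne' hd hm
  have hxy := h.ne
  have hxy' := h'.ne
  simp only [ne_eq, Sym2.eq_iff, not_or, not_and] at hne hne' hd hm
  have : ∃ z, (graph K).Adj a z ∧ (graph K).Adj c z ∧ (x = a ∨ x = c ∨ x = z) ∧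
      (y = a ∨ y = c ∨ y = z) ∧ (x' = a ∨ x' = c ∨ x' = z) ∧ (y' = a ∨ y' = c ∨ y' = z) := by
    have hs := h.symm
    have hs' := h'.symm
    rcases hm with ⟨h1, h2⟩ | ⟨h1, h2⟩ <;>
      rcases merge_eq_merge h1 with rfl | ⟨rfl, rfl⟩ | ⟨rfl, rfl⟩ <;>
      rcases merge_eq_merge h2 with rfl | ⟨rfl, rfl⟩ | ⟨rfl, rfl⟩ <;>
      first
      | (exfalso; tauto)
      | exact ⟨x, by assumption, by assumption, by simp⟩
      | exact ⟨y, by assumption, by assumption, by simp⟩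
  obtain ⟨z, h1, h2, h3⟩ := this
  obtain ⟨F, hF, haF, hcF, hzF⟩ := key z h1 h2
  have hsel : ∀ t, t = a ∨ t = c ∨ t = z → t ∈ F := by
    rintro t (rfl | rfl | rfl) <;> assumption
  exact ⟨F, hF, haF, hcF, hsel _ h3.1, hsel _ h3.2.1, hsel _ h3.2.2.1, hsel _ h3.2.2.2⟩

/-- The new link of `a` consists of the link of `a` without `c` and the link of `c` without `a`, two
paths with common ends. Any other link only has `c` renamed to `a`. Coincidences that would lower a
degree are excluded by `not_two_common`. -/
theorem IsTriangulation.contract (hK : IsTriangulation K) (hgenus : eulerGenus K ≠ 0)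
    (hac : IsFacialEdge K a c) : IsTriangulation (contract K a c) := by
  have hS := hK.isSurfaceOff (fun _ => False)
  have hne := hac.adj.ne
  have hcadj : ∀ {x y}, (graph K).Adj x y → merge a c x ≠ merge a c y →
      (graph (SurfTri.contract K a c)).Adj (merge a c x) (merge a c y) :=
    fun h h' => contract_adj hS (by simp) (by simp) hne h h'
  have hcard : ∀ F ∈ SurfTri.contract K a c, F.card = 3 := by
    intro F hF
    obtain ⟨G, hG, hn, rfl⟩ := mem_contract.1 hF
    rw [Finset.card_image_of_injOn (merge_injOn (s := (G : Set V)) hn), hK.card_face G hG]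
  have hself : ∀ F ∈ K, c ∉ F → F ∈ SurfTri.contract K a c := by
    intro F hF hc
    refine mem_contract.2 ⟨F, hF, fun h => hc h.2, ?_⟩
    have : F.image (merge a c) = F.image id :=
      Finset.image_congr fun x hx => merge_of_ne fun h => hc (h ▸ hx)
    rw [this, Finset.image_id]
  have hreplace : ∀ x y, x ≠ c → y ≠ c → x ≠ a → y ≠ a → {c, x, y} ∈ K →
      {a, x, y} ∈ SurfTri.contract K a c := by
    intro x y hx hy hxa hya h
    refine mem_contract.2 ⟨_, h, ?_, ?_⟩
    · simp [hne, hxa.symm, hya.symm]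
    · simp [Finset.image_insert, merge, hx, hy]
  have hnc : ∀ {F}, F ∈ SurfTri.contract K a c → c ∉ F := by
    intro F hF hc
    obtain ⟨G, hG, hn, rfl⟩ := mem_contract.1 hF
    obtain ⟨x, hx, h⟩ := Finset.mem_image.1 hc
    unfold merge at h
    grind
  have hpre : ∀ {x y z}, {x, y, z} ∈ SurfTri.contract K a c → x ≠ y → x ≠ z → y ≠ z → x ≠ a →
      y ≠ a → {x, y, z} ∈ K ∨ (z = a ∧ {x, y, c} ∈ K) := by
    intro x y z h hxy hxz hyz hxa hya
    obtain ⟨G, hG, hn, himg⟩ := mem_contract.1 h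
    have hm : ∀ t ∈ ({x, y, z} : Finset V), ∃ s ∈ G, merge a c s = t := by
      intro t ht
      exact Finset.mem_image.1 (himg ▸ ht)
    obtain ⟨x', hx', ex⟩ := hm x (by simp)
    obtain ⟨y', hy', ey⟩ := hm y (by simp)
    obtain ⟨z', hz', ez⟩ := hm z (by simp)
    obtain rfl := eq_of_merge_eq ex hxa
    obtain rfl := eq_of_merge_eq ey hya
    have e := eq_triple (hK.card_face G hG) hx' hy' hz' hxy (by rintro rfl; exact hxz (ex.symm.trans ez))
      (by rintro rfl; exact hyz (ey.symm.trans ez))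
    by_cases hzc : z' = c
    · subst hzc
      exact Or.inr ⟨by rw [← ez, merge_self_right], e ▸ hG⟩
    · rw [merge_of_ne hzc] at ez
      subst ez
      exact Or.inl (e ▸ hG)
  have hlink : ∀ {x y}, (link (SurfTri.contract K a c) a).Adj x y ↔
      (x ≠ c ∧ y ≠ c ∧ ((link K a).Adj x y ∨ (x ≠ a ∧ y ≠ a ∧ (link K c).Adj x y))) := by
    intro x y
    rw [link_adj_iff hcard, link_adj_iff hK.card_face, link_adj_iff hK.card_face]
    constructor
    · rintro ⟨hxy, hxa, hya, h⟩
      have hcn := hnc h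
      have h' : {x, y, a} ∈ SurfTri.contract K a c := by convert h using 1; ext; simp; tauto
      have hxc : x ≠ c := fun e => hcn (by simp [e])
      have hyc : y ≠ c := fun e => hcn (by simp [e])
      refine ⟨hxc, hyc, ?_⟩
      rcases hpre h' hxy hxa hya hxa hya with f | ⟨-, f⟩
      · exact Or.inl ⟨hxy, hxa, hya, by convert f using 1; ext; simp; tauto⟩
      · exact Or.inr ⟨hxa, hya, hxy, hxc, hyc, by convert f using 1; ext; simp; tauto⟩
    · rintro ⟨hxc, hyc, ⟨hxy, hxa, hya, h⟩ | ⟨hxa, hya, hxy, -, -, h⟩⟩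
      · exact ⟨hxy, hxa, hya, hself _ h (by simp [hxc.symm, hyc.symm, hne.symm])⟩
      · exact ⟨hxy, hxa, hya, hreplace _ _ hxc hyc hxa hya h⟩
  have hdegA : ∀ x, (graph (SurfTri.contract K a c)).Adj a x →
      ((link (SurfTri.contract K a c) a).neighborSet x).ncard = 2 := by
    intro x hx
    have hxa : x ≠ a := hx.ne'
    have hxc : x ≠ c := by
      rintro rfl
      obtain ⟨-, F, hF, -, h⟩ := hx
      exact hnc hF h
    have hor : (graph K).Adj a x ∨ (graph K).Adj c x := by
      obtain ⟨p, q, hpq, hp, hq⟩ := exists_adj_of_contract_adj hx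
      obtain rfl := eq_of_merge_eq hq hxa
      unfold merge at hp
      split_ifs at hp with h
      · exact Or.inr (h ▸ hpq)
      · exact Or.inl (hp ▸ hpq)
    have heq : (link (SurfTri.contract K a c) a).neighborSet x =
        ((link K a).neighborSet x \ {c}) ∪ ((link K c).neighborSet x \ {a}) := by
      ext y
      simp only [SimpleGraph.mem_neighborSet, hlink, Set.mem_union, Set.mem_sdiff,
        Set.mem_singleton_iff]
      have := fun h : (link K a).Adj x y => h.2.2.1
      have := fun h : (link K c).Adj x y => h.2.2.1
      tauto
    have hempty : ∀ p q, ¬ (graph K).Adj p x → (link K p).neighborSet x \ {q} = ∅ := by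
      intro p q h
      ext y
      simp only [Set.mem_sdiff, SimpleGraph.mem_neighborSet, Set.mem_empty_iff_false, iff_false]
      exact fun h' => h (adj_of_link_adj h'.1)
    have hnot : ∀ p q, ¬ (graph K).Adj q x →
        (link K p).neighborSet x \ {q} = (link K p).neighborSet x := by
      intro p q h
      refine Set.sdiff_singleton_eq_self fun h' => h ?_
      exact (adj_of_link_adj' (SimpleGraph.mem_neighborSet _ _ _ |>.1 h')).symm
    rw [heq]
    -- A common neighbour `x` is an end of both paths and keeps one link neighbour on each; these
    -- differ by `not_two_common`. Any other `x` lies on one path only and keeps both.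
    by_cases h1 : (graph K).Adj a x <;> by_cases h2 : (graph K).Adj c x
    · have hf := hac.face x h1 h2
      have e1 : c ∈ (link K a).neighborSet x := (link_of_mem hf hxc.symm hne.symm hxa).symm
      rw [Finset.insert_comm] at hf
      have e2 : a ∈ (link K c).neighborSet x := (link_of_mem hf hxa.symm hne hxc).symm
      have n1 := hK.link_degree a x h1
      have n2 := hK.link_degree c x h2
      have m1 := Set.ncard_sdiff_singleton_of_mem e1
      have m2 := Set.ncard_sdiff_singleton_of_mem e2
      obtain ⟨p, hp⟩ := Set.ncard_eq_one.1 (by omega : ((link K a).neighborSet x \ {c}).ncard = 1)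
      obtain ⟨q, hq⟩ := Set.ncard_eq_one.1 (by omega : ((link K c).neighborSet x \ {a}).ncard = 1)
      rw [hp, hq]
      refine Set.ncard_pair ?_
      rintro rfl
      have hp' : p ∈ (link K a).neighborSet x \ {c} := by rw [hp]; simp
      have hq' : p ∈ (link K c).neighborSet x \ {a} := by rw [hq]; simp
      obtain ⟨k1, k2, k3, k4⟩ := (link_adj_iff hK.card_face).1 hp'.1
      obtain ⟨l1, l2, l3, l4⟩ := (link_adj_iff hK.card_face).1 hq'.1
      refine hac.not_two_common hK hgenus (x := x) (y := p) ?_ ?_ k1 k2 l2 k3 l3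
      · convert k4 using 1; ext; simp; tauto
      · convert l4 using 1; ext; simp; tauto
    · rw [hempty c a h2, Set.union_empty, hnot a c h2]
      exact hK.link_degree a x h1
    · rw [hempty a c h1, Set.empty_union, hnot c a h1]
      exact hK.link_degree c x h2
    · exact absurd hor (by tauto)
  refine ⟨?_, hcard, ?_, ?_, ?_⟩
  -- If `acy` is a face, then the other face at `ay` avoids `c` and survives.
  · obtain ⟨y, hyc, hy⟩ := hS.exists_face_avoiding (by simp) hac.adj c
    obtain ⟨z, hza, hz⟩ := hS.exists_face_avoiding (v := a) (x := y) (by simp)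
      (adj_of_link_adj hy.symm) c
    exact ⟨_, hself _ ((link_adj_iff hK.card_face).1 hz).2.2.2
      (by simp [hne.symm, hyc.symm, hza.symm])⟩
  · have hvert : ∀ x, IsVertex (SurfTri.contract K a c) x → ∃ x', IsVertex K x' ∧
        merge a c x' = x := by
      rintro x ⟨F, hF, hx⟩
      obtain ⟨G, hG, -, rfl⟩ := mem_contract.1 hF
      obtain ⟨x', hx', rfl⟩ := Finset.mem_image.1 hx
      exact ⟨x', ⟨G, hG, hx'⟩, rfl⟩
    intro x y hx hy
    obtain ⟨x, hx', rfl⟩ := hvert x hx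
    obtain ⟨y, hy', rfl⟩ := hvert y hy
    refine mem_of_reachable_of_closed
      (S := {z | (graph (SurfTri.contract K a c)).Reachable (merge a c x) (merge a c z)})
      ?_ (hK.connected x y hx' hy') (SimpleGraph.Reachable.refl _)
    intro p hp q hpq
    by_cases he : merge a c p = merge a c q
    · change (graph (SurfTri.contract K a c)).Reachable (merge a c x) (merge a c q)
      rw [← he]; exact hp
    · exact SimpleGraph.Reachable.trans hp (hcadj hpq he).reachable
  · intro v x hvx
    by_cases hva : v = a
    · subst hva
      exact hdegA x hvx
    by_cases hxa : x = a
    · subst hxa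
      rw [link_neighborSet_symm _ _ hcard]
      exact hdegA v hvx.symm
    have hadj : (graph K).Adj v x := by
      obtain ⟨p, q, hpq, hp, hq⟩ := exists_adj_of_contract_adj hvx
      obtain rfl := eq_of_merge_eq hp hva
      obtain rfl := eq_of_merge_eq hq hxa
      exact hpq
    have hcvx : v ≠ c ∧ x ≠ c := by
      obtain ⟨-, F, hF, hv, hx⟩ := hvx
      exact ⟨fun h => hnc hF (h ▸ hv), fun h => hnc hF (h ▸ hx)⟩
    have heq : (link (SurfTri.contract K a c) v).neighborSet x =
        merge a c '' (link K v).neighborSet x := by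
      ext y
      simp only [SimpleGraph.mem_neighborSet, Set.mem_image, link_adj_iff hcard,
        link_adj_iff hK.card_face]
      constructor
      · rintro ⟨h1, h2, h3, h4⟩
        rcases hpre h4 h2.symm h3.symm h1 hva hxa with h | ⟨rfl, h⟩
        · refine ⟨y, ⟨h1, h2, h3, h⟩, merge_of_ne ?_⟩
          rintro rfl
          exact hnc h4 (by simp)
        · exact ⟨c, ⟨hcvx.2, h2, hcvx.1.symm, h⟩, merge_self_right⟩
      · rintro ⟨z, ⟨h1, h2, h3, h4⟩, rfl⟩
        by_cases hzc : z = c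
        · subst hzc
          rw [merge_self_right]
          refine ⟨hxa, h2, Ne.symm hva, ?_⟩
          have := hreplace v x hcvx.1 hcvx.2 hva hxa (by convert h4 using 1; ext; simp; tauto)
          convert this using 1; ext; simp; tauto
        · rw [merge_of_ne hzc]
          exact ⟨h1, h2, h3, hself _ h4 (by simp [hcvx.1.symm, hcvx.2.symm, Ne.symm hzc])⟩
    rw [heq, Set.InjOn.ncard_image, hK.link_degree v x hadj]
    apply merge_injOn
    rintro ⟨h1, h2⟩
    obtain ⟨k1, k2, k3, k4⟩ := (link_adj_iff hK.card_face).1 h1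
    obtain ⟨l1, l2, l3, l4⟩ := (link_adj_iff hK.card_face).1 h2
    exact hac.not_two_common hK hgenus k4 l4 k2.symm k3.symm l3.symm k1 l1
  · intro v x y hx hy
    by_cases hva : v = a
    · subst hva
      -- The third vertex `b` of a face at the contracted edge is on both paths, and each path is
      -- connected.
      obtain ⟨b, hb, hbl⟩ := hS.exists_face_avoiding (by simp) hac.adj v
      have hbc : b ≠ c := hbl.ne'
      have hcb : (graph K).Adj c b := adj_of_link_adj' hbl
      have hab : (graph K).Adj v b := adj_of_link_adj hbl.symm
      have main : ∀ x, (graph (SurfTri.contract K v c)).Adj v x →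
          (link (SurfTri.contract K v c) v).Reachable b x := by
        intro x hx
        have hxa : x ≠ v := hx.ne'
        have hxc : x ≠ c := by
          rintro rfl
          obtain ⟨-, F, hF, -, h⟩ := hx
          exact hnc hF h
        have hor : (graph K).Adj v x ∨ (graph K).Adj c x := by
          obtain ⟨p, q, hpq, hp, hq⟩ := exists_adj_of_contract_adj hx
          obtain rfl := eq_of_merge_eq hq hxa
          unfold merge at hp
          split_ifs at hp with h
          · exact Or.inr (h ▸ hpq)
          · exact Or.inl (hp ▸ hpq)
        rcases hor with h | h
        · refine And.right (hS.mem_of_link_closed (v := v) (a := c) (s := b) (y := x)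
            (S := {z | z ≠ c ∧ (link (SurfTri.contract K v c) v).Reachable b z}) (by simp)
            hac.adj (fun h => h.1 rfl) ⟨hbc, SimpleGraph.Reachable.refl _⟩ hab ?_ h hxc)
          rintro p ⟨hp1, hp2⟩ q hpq hq
          exact ⟨hq, hp2.trans (hlink.2 ⟨hp1, hq, Or.inl hpq⟩).reachable⟩
        · refine And.right (hS.mem_of_link_closed (v := c) (a := v) (s := b) (y := x)
            (S := {z | (z ≠ v ∧ z ≠ c) ∧ (link (SurfTri.contract K v c) v).Reachable b z}) (by simp)
            hac.adj.symm (fun h => h.1.1 rfl) ⟨⟨hb, hbc⟩, SimpleGraph.Reachable.refl _⟩ hcb ?_ h hxa)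
          rintro p ⟨⟨hp1, hp3⟩, hp2⟩ q hpq hq
          exact ⟨⟨hq, hpq.2.2.1⟩, hp2.trans
            (hlink.2 ⟨hp3, hpq.2.2.1, Or.inr ⟨hp1, hq, hpq⟩⟩).reachable⟩
      exact (main x hx).symm.trans (main y hy)
    · have hlift : ∀ x, (graph (SurfTri.contract K a c)).Adj v x →
          ∃ x', (graph K).Adj v x' ∧ merge a c x' = x := by
        intro x hx
        obtain ⟨p, q, hpq, hp, hq⟩ := exists_adj_of_contract_adj hx
        obtain rfl := eq_of_merge_eq hp hva
        exact ⟨q, hpq, hq⟩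
      have hvc : v ≠ c := by
        obtain ⟨-, F, hF, hv, -⟩ := hx
        exact fun h => hnc hF (h ▸ hv)
      obtain ⟨x, hx', rfl⟩ := hlift x hx
      obtain ⟨y, hy', rfl⟩ := hlift y hy
      refine mem_of_reachable_of_closed
        (S := {z | (link (SurfTri.contract K a c) v).Reachable (merge a c x) (merge a c z)})
        ?_ (hK.link_connected v x y hx' hy') (SimpleGraph.Reachable.refl _)
      intro p hp q hpq
      change (link (SurfTri.contract K a c) v).Reachable (merge a c x) (merge a c q)
      by_cases he : merge a c p = merge a c q
      · rw [← he]; exact hp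
      · refine SimpleGraph.Reachable.trans hp (SimpleGraph.Adj.reachable ?_)
        have hf := ((link_adj_iff hK.card_face).1 hpq).2.2.2
        have hpv : merge a c p ≠ v := fun h => hpq.2.1 (eq_of_merge_eq h hva)
        have hqv : merge a c q ≠ v := fun h => hpq.2.2.1 (eq_of_merge_eq h hva)
        refine ⟨he, hpv, hqv, _, mem_contract.2 ⟨_, hf, ?_, rfl⟩, ?_, ?_, ?_⟩
        · rintro ⟨h1, h2⟩
          simp only [Finset.mem_insert, Finset.mem_singleton] at h1 h2
          refine he ?_
          unfold merge
          grind
        · exact Finset.mem_image.2 ⟨v, by simp, merge_of_ne hvc⟩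
        · exact Finset.mem_image_of_mem _ (by simp)
        · exact Finset.mem_image_of_mem _ (by simp)

/-- In an irreducible triangulation other than the sphere each edge is on a nonfacial 3-cycle. -/
theorem IsIrreducible.exists_isNonfacial (hK : IsIrreducible K) (hgenus : eulerGenus K ≠ 0)
    (hac : (graph K).Adj a c) : ∃ C, IsNonfacial K C ∧ a ∈ C ∧ c ∈ C := by
  by_contra hcon
  refine hK.not_contractible a c hac ?_
  have hf : IsFacialEdge K a c := by
    refine ⟨hac, fun z ha hc => ?_⟩
    by_contra hn
    refine hcon ⟨{a, c, z}, ⟨Finset.card_eq_three.2 ⟨a, c, z, hac.ne, ha.ne, hc.ne, rfl⟩, hn, ?_⟩,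
      by simp, by simp⟩
    intro x hx y hy hxy
    have := hac.symm
    have := ha.symm
    have := hc.symm
    simp only [Finset.mem_insert, Finset.mem_singleton] at hx hy
    rcases hx with rfl | rfl | rfl <;> rcases hy with rfl | rfl | rfl <;>
      first | assumption | exact absurd rfl hxy
  exact ⟨hac, hf.simple, hK.triangulation.contract hgenus hf⟩

end Irreducible

/-! ### Short paths and the invariant of interior contractions. -/

section Routes

variable {V : Type*}

/-- `u i, x, y, v i` are the vertices, in this order, of a path of length three, or of length two
if `x = y`. -/
structure IsShortRoute (K : FaceSet (CutVertex V)) (i : Fin 3) (x y : CutVertex V) : Prop where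
  left : (graph K).Adj (.u i) x
  middle : x = y ∨ (graph K).Adj x y
  right : (graph K).Adj y (.v i)
  left_ne : x ≠ .v i
  right_ne : y ≠ .u i

def EdgeOnRoute (K : FaceSet (CutVertex V)) (i : Fin 3) (p q : CutVertex V) : Prop :=
  ∃ x y, IsShortRoute K i x y ∧ (s(p, q) = s(.u i, x) ∨ s(p, q) = s(x, y) ∨ s(p, q) = s(y, .v i))

/-- Only inner vertices count; the ends belong to the frame in the application. -/
def VertexOnRoute (K : FaceSet (CutVertex V)) (i : Fin 3) (p : CutVertex V) : Prop :=
  ∃ x y, IsShortRoute K i x y ∧ (p = x ∨ p = y)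

variable {K : FaceSet (CutVertex V)} {i : Fin 3} {p q : CutVertex V}

theorem EdgeOnRoute.symm (h : EdgeOnRoute K i p q) : EdgeOnRoute K i q p := by
  obtain ⟨x, y, h, h'⟩ := h
  exact ⟨x, y, h, by rwa [Sym2.eq_swap]⟩

/-- A short route is a path through its vertices and edges. -/
theorem IsShortRoute.exists_path {x y : CutVertex V} (h : IsShortRoute K i x y) :
    ∃ r : (graph K).Walk (.u i) (.v i), r.IsPath ∧ r.length ≤ 3 ∧ x ∈ r.support ∧ y ∈ r.support ∧
      s(.u i, x) ∈ r.edges ∧ (x ≠ y → s(x, y) ∈ r.edges) ∧ s(y, .v i) ∈ r.edges := by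
  have huv : (CutVertex.u i : CutVertex V) ≠ .v i := by simp
  obtain ⟨h1, h2, h3, h4, h5⟩ := h
  rcases h2 with rfl | h2
  · refine ⟨.cons h1 (.cons h3 .nil), ?_, by simp, by simp, by simp, by simp, by simp, by simp⟩
    simp [SimpleGraph.Walk.isPath_def, h1.ne, huv, h3.ne]
  · refine ⟨.cons h1 (.cons h2 (.cons h3 .nil)), ?_, by simp, by simp, by simp, by simp, by simp,
      by simp⟩
    simp [SimpleGraph.Walk.isPath_def, h1.ne, huv, h3.ne, h2.ne, h5.symm, h4]

theorem EdgeOnRoute.edgeOnShortPath [DecidableEq V] (h : EdgeOnRoute K i p q) (hpq : p ≠ q) :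
    EdgeOnShortPath K i p q := by
  obtain ⟨x, y, h, he⟩ := h
  obtain ⟨r, h1, h2, -, -, h3, h4, h5⟩ := h.exists_path
  refine ⟨r, h1, h2, ?_⟩
  rcases he with he | he | he
  · rwa [he]
  · rw [he]
    refine h4 ?_
    rintro rfl
    simp only [Sym2.eq_iff, or_self] at he
    exact hpq (he.1.trans he.2.symm)
  · rwa [he]

theorem VertexOnRoute.vertexOnShortPath [DecidableEq V] (h : VertexOnRoute K i p) :
    VertexOnShortPath K i p := by
  obtain ⟨x, y, h, he⟩ := h
  obtain ⟨r, h1, h2, h3, h4, -⟩ := h.exists_path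
  exact ⟨r, h1, h2, by rcases he with rfl | rfl <;> assumption⟩

variable [DecidableEq V]

/-- The first and last edges have a frame end, so only the middle edge can collapse; this is why a
route may have `x = y`. -/
theorem IsShortRoute.contract {B : CutVertex V → Prop} {a c x y : CutVertex V}
    (hK : IsSurfaceOff K B) (ha : ¬ B a) (hc : ¬ B c) (hac : a ≠ c) (hu : B (.u i)) (hv : B (.v i))
    (h : IsShortRoute K i x y) :
    IsShortRoute (contract K a c) i (merge a c x) (merge a c y) := by
  have eu : merge a c (.u i) = .u i := merge_frame hc hu
  have ev : merge a c (.v i) = .v i := merge_frame hc hv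
  have hua : (.u i : CutVertex V) ≠ a := fun h => ha (h ▸ hu)
  have hva : (.v i : CutVertex V) ≠ a := fun h => ha (h ▸ hv)
  refine ⟨?_, ?_, ?_, fun e => h.left_ne (eq_of_merge_eq e hva),
    fun e => h.right_ne (eq_of_merge_eq e hua)⟩
  · have := contract_adj hK ha hc hac h.left
      (by rw [eu]; exact fun e => h.left.ne (eq_of_merge_eq e.symm hua).symm)
    rwa [eu] at this
  · by_cases he : merge a c x = merge a c y
    · exact Or.inl he
    · exact Or.inr (contract_adj hK ha hc hac
        (h.middle.resolve_left fun e => he (by rw [e])) he)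
  · have := contract_adj hK ha hc hac h.right
      (by rw [ev]; exact fun e => h.right.ne (eq_of_merge_eq e hva))
    rwa [ev] at this

/-- The property that is preserved by interior contractions: edges and vertices are on short
routes or on nonfacial 3-cycles that do not become facial. -/
structure IsCovered (cap K : FaceSet (CutVertex V)) : Prop where
  surface : IsSurfaceOff K (IsFrameVertex cap)
  edge : ∀ p q, (graph K).Adj p q → IsFrameEdge cap p q ∨ (∃ i, EdgeOnRoute K i p q) ∨
    ∃ C, IsNonfacial K C ∧ IsTightAround K (IsFrameVertex cap) C ∧ p ∈ C ∧ q ∈ C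
  vertex : ∀ p, IsVertex K p → IsFrameVertex cap p ∨
    (∃ i j, i < j ∧ VertexOnRoute K i p ∧ VertexOnRoute K j p) ∨
    ∃ C, IsNonfacial K C ∧ IsTightAround K (IsFrameVertex cap) C ∧ p ∈ C

/-- Every edge and vertex of the contracted complex has a preimage, and the image of the certificate
of the preimage is a certificate of the same kind. -/
theorem IsCovered.contract {cap : FaceSet (CutVertex V)} (hu : ∀ i, IsFrameVertex cap (.u i))
    (hv : ∀ i, IsFrameVertex cap (.v i)) {a c : CutVertex V} (ha : ¬ IsFrameVertex cap a)
    (hc : ¬ IsFrameVertex cap c) (hac : IsContractible K a c) (h : IsCovered cap K) :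
    IsCovered cap (contract K a c) := by
  have hS := h.surface
  have hf := hac.isFacialEdge hS.card_face
  have hroute : ∀ {i x y}, IsShortRoute K i x y →
      IsShortRoute (SurfTri.contract K a c) i (merge a c x) (merge a c y) :=
    fun {i x y} hr => hr.contract hS ha hc hac.edge.ne (hu i) (hv i)
  have hvroute : ∀ {i x}, VertexOnRoute K i x →
      VertexOnRoute (SurfTri.contract K a c) i (merge a c x) := by
    rintro i x ⟨y, z, hr, he⟩
    exact ⟨_, _, hroute hr, he.imp (congrArg _) (congrArg _)⟩
  refine ⟨hac.triangulation.isSurfaceOff _, ?_, ?_⟩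
  · intro p q hpq
    obtain ⟨p, q, hpq', rfl, rfl⟩ := exists_adj_of_contract_adj hpq
    rcases h.edge p q hpq' with he | ⟨i, x, y, hr, he⟩ | ⟨C, hC, hT, hp, hq⟩
    · left
      obtain ⟨hne, F, hF, hpF, hqF⟩ := he
      rw [merge_frame (B := IsFrameVertex cap) hc ⟨F, hF, hpF⟩,
        merge_frame (B := IsFrameVertex cap) hc ⟨F, hF, hqF⟩]
      exact ⟨hne, F, hF, hpF, hqF⟩
    · refine Or.inr (Or.inl ⟨i, _, _, hroute hr, ?_⟩)
      have e1 : merge a c (.u i) = .u i := merge_frame hc (hu i)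
      have e2 : merge a c (.v i) = .v i := merge_frame hc (hv i)
      have hmap : ∀ {p q r r' : CutVertex V}, s(p, q) = s(r, r') →
          s(merge a c p, merge a c q) = s(merge a c r, merge a c r') := by
        intro p q r r' h
        simpa using congrArg (Sym2.map (merge a c)) h
      rcases he with he | he | he
      · exact Or.inl (by rw [hmap he, e1])
      · exact Or.inr (Or.inl (hmap he))
      · exact Or.inr (Or.inr (by rw [hmap he, e2]))
    · exact Or.inr (Or.inr ⟨_, hC.contract hS ha hc hf hT, hT.contract hS ha hc hf hC,
        Finset.mem_image_of_mem _ hp, Finset.mem_image_of_mem _ hq⟩)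
  · rintro p ⟨F, hF, hp⟩
    obtain ⟨G, hG, -, rfl⟩ := mem_contract.1 hF
    obtain ⟨p, hpG, rfl⟩ := Finset.mem_image.1 hp
    rcases h.vertex p ⟨G, hG, hpG⟩ with he | ⟨i, j, hij, h1, h2⟩ | ⟨C, hC, hT, hp⟩
    · left
      rwa [merge_frame hc he]
    · exact Or.inr (Or.inl ⟨i, j, hij, hvroute h1, hvroute h2⟩)
    · exact Or.inr (Or.inr ⟨_, hC.contract hS ha hc hf hT, hT.contract hS ha hc hf hC,
        Finset.mem_image_of_mem _ hp⟩)

theorem IsCovered.of_interiorContractions {cap K' K'' : FaceSet (CutVertex V)}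
    (hu : ∀ i, IsFrameVertex cap (.u i)) (hv : ∀ i, IsFrameVertex cap (.v i))
    (h : IsCovered cap K') (hK : Relation.ReflTransGen (InteriorContraction cap) K' K'') :
    IsCovered cap K'' := by
  induction hK with
  | refl => exact h
  | tail _ hstep ih =>
    obtain ⟨a, c, ha, hc, hac, rfl⟩ := hstep
    exact ih.contract hu hv ha hc hac

end Routes

/-! ### Lifting 3-cycles and links to the cut and capped surface. -/

section CutCapBase

variable {V : Type*}

/-- The two vertices that come from the `i`-th vertex of the 3-cycle. -/
def copy (i : Fin 3) (s : Bool) : CutVertex V := if s then .u i else .v i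

/-- The vertex of the original surface from which a vertex comes. -/
def proj (w : Fin 3 → V) : CutVertex V → V
  | .old x => x
  | .u i => w i
  | .v i => w i
  -- An arbitrary value: `t` is not adjacent to any old vertex, and `proj` matters only for old
  -- vertices and their neighbours.
  | .t => w 0

theorem proj_copy (w : Fin 3 → V) (i : Fin 3) (s : Bool) : proj w (copy i s) = w i := by
  cases s <;> rfl

theorem old_ne_copy (x : V) (i : Fin 3) (s : Bool) : CutVertex.old x ≠ copy i s := by
  cases s <;> simp [copy]

variable [DecidableEq V]

/-- What both kinds of cut/cap operations have in common. -/
structure IsCapping (K : FaceSet V) (w : Fin 3 → V) (side : Fin 3 → Finset V → Bool)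
    (cap : FaceSet (CutVertex V)) : Prop where
  injective : Function.Injective w
  same : ∀ i, ∀ F ∈ K, ∀ G ∈ K, ∀ x, x ∉ Set.range w →
    w i ∈ F → w i ∈ G → x ∈ F → x ∈ G → side i F = side i G
  frame_copy : ∀ i s, IsFrameVertex cap (copy i s)
  not_frame_old : ∀ x, ¬ IsFrameVertex cap (.old x)
  card_face : ∀ F ∈ cap, F.card = 3
  -- For both caps the frame joins the copies of `w i` to those of `w j` by a perfect matching.
  cross : ∀ i j, i ≠ j → ∀ s s', (graph cap).Adj (copy i s) (copy j s') ∨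
    ((graph cap).Adj (copy i s) (copy j !s') ∧ (graph cap).Adj (copy i !s) (copy j s'))
  not_adj : ∀ i s, ¬ (graph cap).Adj (copy i s) (copy i !s)
  adj_side : ∀ i j, i ≠ j → ∀ F ∈ K, w i ∈ F → w j ∈ F →
    (graph cap).Adj (copy i (side i F)) (copy j (side j F))

theorem IsCutCap.exists_isCapping {K : FaceSet V} {w : Fin 3 → V} (hw : IsThreeCycle K w)
    {K' cap : FaceSet (CutVertex V)} (h : IsCutCap K w K' cap) :
    ∃ side, K' = cut K w side ∪ cap ∧ IsCapping K w side cap := by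
  obtain ⟨side, hK', h⟩ := h
  have hinj : Function.Injective w := by
    intro i j hij
    by_contra hne
    exact (hw i j hne).ne hij
  refine ⟨side, hK', ?_⟩
  rcases h with ⟨⟨hl, h2⟩, rfl⟩ | ⟨⟨hl, h01, h12, h20⟩, rfl⟩
  · refine ⟨hinj, hl.same, ?_, ?_, ?_, ?_, ?_, ?_⟩
    · intro i s
      fin_cases i <;> cases s <;> simp [IsFrameVertex, IsVertex, handleCap, copy]
    · intro x
      simp [IsFrameVertex, IsVertex, handleCap]
    · intro F hF
      simp only [handleCap, Finset.mem_insert, Finset.mem_singleton] at hF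
      rcases hF with rfl | rfl <;> rfl
    · intro i j hij s s'
      fin_cases i <;> fin_cases j <;> first | exact absurd rfl hij |
        (cases s <;> cases s' <;> simp [graph, handleCap, copy])
    · intro i s
      cases s <;> simp [graph, handleCap, copy]
    · intro i j hij F hF hi hj
      rw [h2 i j F hF hi hj]
      generalize side j F = s
      fin_cases i <;> fin_cases j <;> first | exact absurd rfl hij |
        (cases s <;> simp [graph, handleCap, copy])
  · refine ⟨hinj, hl.same, ?_, ?_, ?_, ?_, ?_, ?_⟩
    · intro i s
      fin_cases i <;> cases s <;> simp [IsFrameVertex, IsVertex, crosscapCap, copy]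
    · intro x
      simp [IsFrameVertex, IsVertex, crosscapCap]
    · intro F hF
      simp only [crosscapCap, Finset.mem_insert, Finset.mem_singleton] at hF
      rcases hF with rfl | rfl | rfl | rfl | rfl | rfl <;> rfl
    · intro i j hij s s'
      fin_cases i <;> fin_cases j <;> first | exact absurd rfl hij |
        (cases s <;> cases s' <;> simp [graph, crosscapCap, copy])
    · intro i s
      fin_cases i <;> cases s <;> simp [graph, crosscapCap, copy]
    · have a01 : ∀ s, (graph (crosscapCap V)).Adj (copy 0 s) (copy 1 s) := by
        intro s; cases s <;> simp [graph, crosscapCap, copy]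
      have a12 : ∀ s, (graph (crosscapCap V)).Adj (copy 1 s) (copy 2 s) := by
        intro s; cases s <;> simp [graph, crosscapCap, copy]
      have a20 : ∀ s s', s ≠ s' → (graph (crosscapCap V)).Adj (copy 2 s) (copy 0 s') := by
        intro s s' h; cases s <;> cases s' <;> simp [graph, crosscapCap, copy] at h ⊢
      intro i j hij F hF hi hj
      fin_cases i <;> fin_cases j
      · exact absurd rfl hij
      · simpa [h01 F hF hi hj] using a01 (side 1 F)
      · exact (a20 _ _ (h20 F hF hj hi)).symm
      · simpa [h01 F hF hj hi] using (a01 (side 1 F)).symm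
      · exact absurd rfl hij
      · simpa [h12 F hF hi hj] using a12 (side 2 F)
      · exact a20 _ _ (h20 F hF hi hj)
      · simpa [h12 F hF hj hi] using (a12 (side 2 F)).symm
      · exact absurd rfl hij

variable {K : FaceSet V} {w : Fin 3 → V} {side : Fin 3 → Finset V → Bool}
  {cap : FaceSet (CutVertex V)}

theorem proj_liftVertex (F : Finset V) (x : V) : proj w (liftVertex w side F x) = x := by
  unfold liftVertex
  split_ifs <;> simp_all [proj]

theorem liftVertex_old (F : Finset V) {x : V} (hx : x ∉ Set.range w) :
    liftVertex w side F x = .old x := by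
  have : ∀ i, x ≠ w i := fun i h => hx ⟨i, h.symm⟩
  simp [liftVertex, this]

theorem liftVertex_w (hw : Function.Injective w) (F : Finset V) (i : Fin 3) :
    liftVertex w side F (w i) = copy i (side i F) := by
  fin_cases i <;> simp [liftVertex, copy, hw.eq_iff]

theorem not_mem_range_of_liftVertex (hw : Function.Injective w) {F : Finset V} {x y : V}
    (h : liftVertex w side F y = .old x) : y = x ∧ x ∉ Set.range w := by
  have e : y = x := by
    rw [← proj_liftVertex (w := w) (side := side) F y, h, proj]
  refine ⟨e, ?_⟩
  rintro ⟨i, rfl⟩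
  rw [e, liftVertex_w hw] at h
  exact old_ne_copy _ _ _ h.symm

theorem mem_cut_union {F' : Finset (CutVertex V)} :
    F' ∈ cut K w side ∪ cap ↔ (∃ F ∈ K, F.image (liftVertex w side F) = F') ∨ F' ∈ cap := by
  simp [cut]

theorem adj_cut_union_of_cap {p q : CutVertex V} (h : (graph cap).Adj p q) :
    (graph (cut K w side ∪ cap)).Adj p q := by
  obtain ⟨hne, F, hF, hp, hq⟩ := h
  exact ⟨hne, F, Finset.mem_union_right _ hF, hp, hq⟩

/-- A 3-cycle that is broken by the cut gives a route between the copies of a vertex. -/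
theorem onRoute_of_broken {x : V} {p : CutVertex V} {i : Fin 3} {s : Bool}
    (hp : (graph (cut K w side ∪ cap)).Adj (.old x) p)
    (hq : (graph (cut K w side ∪ cap)).Adj (.old x) (copy i s)) (hpq : p ≠ copy i s)
    (hb : (graph (cut K w side ∪ cap)).Adj p (copy i !s)) :
    EdgeOnRoute (cut K w side ∪ cap) i (.old x) p ∧
      EdgeOnRoute (cut K w side ∪ cap) i (.old x) (copy i s) ∧
      VertexOnRoute (cut K w side ∪ cap) i (.old x) := by
  -- The route is `u i, p, old x, v i` if the copy adjacent to `old x` is `v i`, and `u i, old x, p,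
  -- v i` otherwise.
  cases s
  · have hr : IsShortRoute (cut K w side ∪ cap) i p (.old x) :=
      ⟨hb.symm, Or.inr hp.symm, hq, hpq, by simp⟩
    exact ⟨⟨_, _, hr, Or.inr (Or.inl Sym2.eq_swap)⟩, ⟨_, _, hr, Or.inr (Or.inr rfl)⟩,
      ⟨_, _, hr, Or.inr rfl⟩⟩
  · have hr : IsShortRoute (cut K w side ∪ cap) i (.old x) p :=
      ⟨hq.symm, Or.inr hp, hb, by simp, hpq⟩
    exact ⟨⟨_, _, hr, Or.inr (Or.inl rfl)⟩, ⟨_, _, hr, Or.inl Sym2.eq_swap⟩,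
      ⟨_, _, hr, Or.inl rfl⟩⟩

namespace IsCapping

variable (hc : IsCapping K w side cap)
include hc

theorem adj_old_iff {x : V} {p : CutVertex V} :
    (graph (cut K w side ∪ cap)).Adj (.old x) p ↔
      x ∉ Set.range w ∧ ∃ F ∈ K, x ∈ F ∧ ∃ y ∈ F, y ≠ x ∧ liftVertex w side F y = p := by
  constructor
  · rintro ⟨hne, F', hF', hx, hp⟩
    rcases mem_cut_union.1 hF' with ⟨F, hF, rfl⟩ | h
    · obtain ⟨x', hx', e⟩ := Finset.mem_image.1 hx
      obtain ⟨y, hy, rfl⟩ := Finset.mem_image.1 hp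
      obtain ⟨rfl, hxw⟩ := not_mem_range_of_liftVertex hc.injective e
      exact ⟨hxw, F, hF, hx', y, hy, fun h => hne (by rw [h, e]), rfl⟩
    · exact absurd ⟨F', h, hx⟩ (hc.not_frame_old x)
  · rintro ⟨hxw, F, hF, hx, y, hy, hyx, rfl⟩
    refine ⟨fun h => hyx ?_, _, mem_cut_union.2 (Or.inl ⟨F, hF, rfl⟩),
      Finset.mem_image.2 ⟨x, hx, liftVertex_old F hxw⟩, Finset.mem_image_of_mem _ hy⟩
    exact (not_mem_range_of_liftVertex hc.injective h.symm).1

theorem proj_adj {x : V} {p : CutVertex V}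
    (h : (graph (cut K w side ∪ cap)).Adj (.old x) p) : (graph K).Adj x (proj w p) := by
  obtain ⟨-, F, hF, hx, y, hy, hyx, rfl⟩ := hc.adj_old_iff.1 h
  rw [proj_liftVertex]
  exact ⟨hyx.symm, F, hF, hx, hy⟩

theorem exists_lift {x y : V} (hx : x ∉ Set.range w) (h : (graph K).Adj x y) :
    ∃ p, (graph (cut K w side ∪ cap)).Adj (.old x) p ∧ proj w p = y := by
  obtain ⟨hne, F, hF, hxF, hyF⟩ := h
  exact ⟨_, hc.adj_old_iff.2 ⟨hx, F, hF, hxF, y, hyF, hne.symm, rfl⟩, proj_liftVertex F y⟩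

/-- The edges at an old vertex have only one lift. -/
theorem lift_unique {x : V} {p q : CutVertex V}
    (hp : (graph (cut K w side ∪ cap)).Adj (.old x) p)
    (hq : (graph (cut K w side ∪ cap)).Adj (.old x) q) (h : proj w p = proj w q) : p = q := by
  obtain ⟨hxw, F, hF, hx, y, hy, -, rfl⟩ := hc.adj_old_iff.1 hp
  obtain ⟨-, G, hG, hx', z, hz, -, rfl⟩ := hc.adj_old_iff.1 hq
  rw [proj_liftVertex, proj_liftVertex] at h
  subst h
  -- Faces sharing an edge from `x` to `w i` are on the same side there, as `x` is off the 3-cycle.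
  by_cases hyw : y ∈ Set.range w
  · obtain ⟨i, rfl⟩ := hyw
    rw [liftVertex_w hc.injective, liftVertex_w hc.injective,
      hc.same i F hF G hG x hxw hy hz hx hx']
  · rw [liftVertex_old F hyw, liftVertex_old G hyw]

theorem old_or_copy {x : V} {p : CutVertex V}
    (h : (graph (cut K w side ∪ cap)).Adj (.old x) p) :
    (∃ y, y ∉ Set.range w ∧ p = .old y) ∨ ∃ i s, p = copy i s := by
  obtain ⟨-, F, hF, -, y, hy, -, rfl⟩ := hc.adj_old_iff.1 h
  by_cases hyw : y ∈ Set.range w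
  · obtain ⟨i, rfl⟩ := hyw
    exact Or.inr ⟨i, _, liftVertex_w hc.injective F i⟩
  · exact Or.inl ⟨y, hyw, liftVertex_old F hyw⟩

/-- An edge of a cut face between two copies comes from an edge of the 3-cycle `w`, so it is on the
boundary that is capped. -/
theorem frameEdge_or_old {p q : CutVertex V} (h : (graph (cut K w side ∪ cap)).Adj p q) :
    IsFrameEdge cap p q ∨ (∃ x, p = .old x) ∨ ∃ x, q = .old x := by
  obtain ⟨hne, F', hF', hp, hq⟩ := h
  rcases mem_cut_union.1 hF' with ⟨F, hF, rfl⟩ | h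
  · obtain ⟨x, hx, rfl⟩ := Finset.mem_image.1 hp
    obtain ⟨y, hy, rfl⟩ := Finset.mem_image.1 hq
    by_cases hxw : x ∈ Set.range w
    · by_cases hyw : y ∈ Set.range w
      · obtain ⟨i, rfl⟩ := hxw
        obtain ⟨j, rfl⟩ := hyw
        left
        rw [liftVertex_w hc.injective, liftVertex_w hc.injective]
        exact hc.adj_side i j (by rintro rfl; exact hne rfl) F hF hx hy
      · exact Or.inr (Or.inr ⟨y, liftVertex_old F hyw⟩)
    · exact Or.inr (Or.inl ⟨x, liftVertex_old F hxw⟩)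
  · exact Or.inl ⟨hne, F', h, hp, hq⟩

theorem old_of_vertex {p : CutVertex V} (h : IsVertex (cut K w side ∪ cap) p)
    (hp : ¬ IsFrameVertex cap p) : ∃ x, p = .old x ∧ x ∉ Set.range w ∧ IsVertex K x := by
  obtain ⟨F', hF', hpF⟩ := h
  rcases mem_cut_union.1 hF' with ⟨F, hF, rfl⟩ | h
  · obtain ⟨x, hx, rfl⟩ := Finset.mem_image.1 hpF
    by_cases hxw : x ∈ Set.range w
    · obtain ⟨i, rfl⟩ := hxw
      rw [liftVertex_w hc.injective] at hp
      exact absurd (hc.frame_copy _ _) hp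
    · exact ⟨x, liftVertex_old F hxw, hxw, F, hF, hx⟩
  · exact absurd ⟨F', h, hpF⟩ hp

theorem not_adj_copy (i : Fin 3) (s : Bool) :
    ¬ (graph (cut K w side ∪ cap)).Adj (copy i s) (copy i !s) := by
  intro h
  rcases hc.frameEdge_or_old h with h | ⟨x, h⟩ | ⟨x, h⟩
  · exact hc.not_adj i s h
  · exact old_ne_copy _ _ _ h.symm
  · exact old_ne_copy _ _ _ h.symm

theorem adj_or_adj_copy {y : V} (hy : y ∉ Set.range w) {i : Fin 3} (h : (graph K).Adj y (w i))
    (s : Bool) : (graph (cut K w side ∪ cap)).Adj (.old y) (copy i s) ∨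
      (graph (cut K w side ∪ cap)).Adj (.old y) (copy i !s) := by
  obtain ⟨p, hp, hpw⟩ := hc.exists_lift hy h
  rcases hc.old_or_copy hp with ⟨z, hz, rfl⟩ | ⟨j, s', rfl⟩
  · exact absurd ⟨i, hpw.symm⟩ hz
  · rw [proj_copy] at hpw
    obtain rfl := hc.injective hpw
    cases s <;> cases s' <;> simp_all

/-- If `x, y, z` is a 3-cycle and the edges `xy` and `xz` lift to `old x, p` and `old x, q`, then
either the 3-cycle lifts, or it becomes paths connecting the two copies of a vertex. -/
theorem closed_or_broken {x : V} {p q : CutVertex V}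
    (hp : (graph (cut K w side ∪ cap)).Adj (.old x) p)
    (hq : (graph (cut K w side ∪ cap)).Adj (.old x) q) (h : (graph K).Adj (proj w p) (proj w q)) :
    (graph (cut K w side ∪ cap)).Adj p q ∨ (∃ i s, p = copy i s ∨ q = copy i s) ∧
      (∀ i s, p = copy i s → (graph (cut K w side ∪ cap)).Adj q (copy i !s)) ∧
      ∀ i s, q = copy i s → (graph (cut K w side ∪ cap)).Adj p (copy i !s) := by
  have hinj : ∀ {i j s s'}, (copy i s : CutVertex V) = copy j s' → i = j ∧ s = s' := by
    intro i j s s' h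
    cases s <;> cases s' <;> simp_all [copy]
  -- The edge opposite to `x` always lifts, but if one of its ends is some `w i`, the lift may
  -- arrive at the wrong copy. Then the 3-cycle is broken there.
  rcases hc.old_or_copy hp with ⟨y, hy, rfl⟩ | ⟨i, s, rfl⟩ <;>
    rcases hc.old_or_copy hq with ⟨z, hz, rfl⟩ | ⟨j, s', rfl⟩
  · left
    obtain ⟨hne, F, hF, hyF, hzF⟩ := h
    exact hc.adj_old_iff.2 ⟨hy, F, hF, hyF, z, hzF, hne.symm, liftVertex_old F hz⟩
  · rw [proj_copy] at h
    refine (hc.adj_or_adj_copy hy h s').imp_right fun h' => ⟨⟨j, s', Or.inr rfl⟩, ?_, ?_⟩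
    · intro i s e
      exact absurd e (old_ne_copy _ _ _)
    · intro i s e
      obtain ⟨rfl, rfl⟩ := hinj e
      exact h'
  · rw [proj_copy] at h
    refine (hc.adj_or_adj_copy hz h.symm s).imp (fun h' => h'.symm)
      fun h' => ⟨⟨i, s, Or.inl rfl⟩, ?_, ?_⟩
    · intro i s e
      obtain ⟨rfl, rfl⟩ := hinj e
      exact h'
    · intro i s e
      exact absurd e (old_ne_copy _ _ _)
  · rw [proj_copy, proj_copy] at h
    refine (hc.cross i j (by rintro rfl; exact h.ne rfl) s s').imp adj_cut_union_of_cap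
      fun h' => ⟨⟨i, s, Or.inl rfl⟩, ?_, ?_⟩
    · intro i s e
      obtain ⟨rfl, rfl⟩ := hinj e
      exact (adj_cut_union_of_cap h'.2).symm
    · intro i s e
      obtain ⟨rfl, rfl⟩ := hinj e
      exact adj_cut_union_of_cap h'.1

/-- A face at an old vertex is not in the cap, and cut faces project to faces of `K`. -/
theorem isNonfacial_lift {x : V} {p q : CutVertex V}
    (hp : (graph (cut K w side ∪ cap)).Adj (.old x) p)
    (hq : (graph (cut K w side ∪ cap)).Adj (.old x) q)
    (hpq : (graph (cut K w side ∪ cap)).Adj p q)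
    (h : ({x, proj w p, proj w q} : Finset V) ∉ K) :
    IsNonfacial (cut K w side ∪ cap) {.old x, p, q} := by
  refine ⟨Finset.card_eq_three.2 ⟨_, _, _, hp.ne, hq.ne, hpq.ne, rfl⟩, ?_, ?_⟩
  · intro hF'
    rcases mem_cut_union.1 hF' with ⟨F, hF, e⟩ | h'
    · have := congrArg (Finset.image (proj w)) e
      simp only [Finset.image_image, Finset.image_insert, Finset.image_singleton] at this
      have hid : proj w ∘ liftVertex w side F = id := funext fun y => proj_liftVertex F y
      rw [hid, Finset.image_id] at this
      exact h (this ▸ hF)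
    · exact hc.not_frame_old x ⟨_, h', by simp⟩
  · intro y hy z hz hyz
    have := hp.symm
    have := hq.symm
    have := hpq.symm
    simp only [Finset.mem_insert, Finset.mem_singleton] at hy hz
    rcases hy with rfl | rfl | rfl <;> rcases hz with rfl | rfl | rfl <;>
      first | assumption | exact absurd rfl hyz

/-- A nonfacial 3-cycle through `x` and `proj w p`, where the edge `old x, p` is given, lifts to
a nonfacial 3-cycle or breaks. -/
theorem exists_third_lift (hT : ∀ a b, (graph K).Adj a b → ∃ C, IsNonfacial K C ∧ a ∈ C ∧ b ∈ C)
    {x : V} {p : CutVertex V} (hp : (graph (cut K w side ∪ cap)).Adj (.old x) p) :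
    ∃ q, (graph (cut K w side ∪ cap)).Adj (.old x) q ∧ ({x, proj w p, proj w q} : Finset V) ∉ K ∧
      p ≠ q ∧ (IsNonfacial (cut K w side ∪ cap) {.old x, p, q} ∨
      ¬ (graph (cut K w side ∪ cap)).Adj p q ∧ (∃ i s, p = copy i s ∨ q = copy i s) ∧
      (∀ i s, p = copy i s → (graph (cut K w side ∪ cap)).Adj q (copy i !s)) ∧
      ∀ i s, q = copy i s → (graph (cut K w side ∪ cap)).Adj p (copy i !s)) := by
  have hadj := hc.proj_adj hp
  obtain ⟨C, hC, hxC, hyC⟩ := hT x _ hadj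
  obtain ⟨z, hzx, hzp, rfl⟩ := exists_third hC.1 hxC hyC hadj.ne
  obtain ⟨q, hq, rfl⟩ := hc.exists_lift (hc.adj_old_iff.1 hp).1
    (hC.2.2 x hxC z (by simp) hzx.symm)
  refine ⟨q, hq, hC.2.1, by rintro rfl; exact hzp rfl, ?_⟩
  by_cases hpq : (graph (cut K w side ∪ cap)).Adj p q
  · exact Or.inl (hc.isNonfacial_lift hp hq hpq hC.2.1)
  · exact Or.inr ⟨hpq, (hc.closed_or_broken hp hq
      (hC.2.2 _ hyC _ (by simp) hzp.symm)).resolve_left hpq⟩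

/-- Suppose the 3-cycle for an edge at `old x ∈ I` breaks at the copies of `w i`. These are frame
vertices, so the copy adjacent to `old x` is in `C`. If the other neighbour involved is in `I`, the
second copy is in `C` too, but the copies are not adjacent. If it is in `C`, it is adjacent to the
first copy and the 3-cycle was not broken. -/
theorem isTightAround (hT : ∀ a b, (graph K).Adj a b → ∃ C, IsNonfacial K C ∧ a ∈ C ∧ b ∈ C)
    {C : Finset (CutVertex V)} (hC : IsNonfacial (cut K w side ∪ cap) C) :
    IsTightAround (cut K w side ∪ cap) (IsFrameVertex cap) C := by
  intro I hIB hIC hI x' hx p hp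
  obtain ⟨x, rfl, -⟩ := hc.old_of_vertex
    (by obtain ⟨-, F, hF, h, -⟩ := hp; exact ⟨F, hF, h⟩) (hIB x' hx)
  obtain ⟨q, hq, -, hpq, hN | ⟨hn, ⟨i, s, hor⟩, hbp, hbq⟩⟩ := hc.exists_third_lift hT hp
  · exact ⟨_, hN, by simp, by simp⟩
  exfalso
  have key : ∀ p q : CutVertex V, (graph (cut K w side ∪ cap)).Adj (.old x) p →
      (graph (cut K w side ∪ cap)).Adj (.old x) q → p ≠ q →
      ¬ (graph (cut K w side ∪ cap)).Adj p q →
      q = copy i s → (graph (cut K w side ∪ cap)).Adj p (copy i !s) → False := by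
    rintro p q hp hq hpq hn rfl hb
    have hcopy : ∀ s, (copy i s) ∉ I := fun s h => hIB _ h (hc.frame_copy i s)
    have hqC : copy i s ∈ C := (hI _ hx _ hq).resolve_left (hcopy s)
    rcases hI _ hx _ hp with h | h
    · have : copy i (!s) ∈ C := (hI _ h _ hb).resolve_left (hcopy _)
      exact hc.not_adj_copy i s (hC.2.2 _ hqC _ this (by cases s <;> simp [copy]))
    · exact hn (hC.2.2 _ h _ hqC hpq)
  rcases hor with h | h
  · exact key q p hq hp hpq.symm (fun h => hn h.symm) h (hbp i s h)
  · exact key p q hp hq hpq hn h (hbq i s h)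

theorem link_lift {x y : V} {p : CutVertex V}
    (hp : (graph (cut K w side ∪ cap)).Adj (.old x) p) (h : (link K x).Adj (proj w p) y) :
    ∃ q, (link (cut K w side ∪ cap) (.old x)).Adj p q ∧ proj w q = y := by
  have hxw := (hc.adj_old_iff.1 hp).1
  obtain ⟨h1, h2, h3, F, hF, hx, hpF, hy⟩ := h
  have hp' := hc.adj_old_iff.2 ⟨hxw, F, hF, hx, _, hpF, h2, rfl⟩
  have hq := hc.adj_old_iff.2 ⟨hxw, F, hF, hx, y, hy, h3, rfl⟩
  have e := hc.lift_unique hp hp' (by rw [proj_liftVertex])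
  refine ⟨liftVertex w side F y, ⟨?_, hp.ne', hq.ne', F.image (liftVertex w side F),
    mem_cut_union.2 (Or.inl ⟨F, hF, rfl⟩), ?_, ?_, Finset.mem_image_of_mem _ hy⟩,
    proj_liftVertex F y⟩
  · intro h
    exact h1 (by rw [h, proj_liftVertex])
  · exact Finset.mem_image.2 ⟨x, hx, liftVertex_old F hxw⟩
  · rw [e]
    exact Finset.mem_image_of_mem _ hpF

theorem link_proj {x : V} {p q : CutVertex V}
    (h : (link (cut K w side ∪ cap) (.old x)).Adj p q) :
    (link K x).Adj (proj w p) (proj w q) := by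
  obtain ⟨h1, h2, h3, F', hF', hx, hp, hq⟩ := h
  have hax := adj_of_face hF' hx hp h2.symm
  have hay := adj_of_face hF' hx hq h3.symm
  rcases mem_cut_union.1 hF' with ⟨F, hF, rfl⟩ | h'
  · obtain ⟨y, hy, rfl⟩ := Finset.mem_image.1 hp
    obtain ⟨z, hz, rfl⟩ := Finset.mem_image.1 hq
    obtain ⟨x', hx', e⟩ := Finset.mem_image.1 hx
    obtain ⟨rfl, -⟩ := not_mem_range_of_liftVertex hc.injective e
    refine ⟨?_, (hc.proj_adj hax).ne', (hc.proj_adj hay).ne', F, hF, hx', ?_, ?_⟩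
    · simp only [proj_liftVertex]
      rintro rfl
      exact h1 rfl
    · rwa [proj_liftVertex]
    · rwa [proj_liftVertex]
  · exact absurd ⟨F', h', hx⟩ (hc.not_frame_old x)

/-- The cut leaves the star of an old vertex intact: `proj` maps its link isomorphically onto the
link in `K`. -/
theorem isSurfaceOff (hK : IsTriangulation K) :
    IsSurfaceOff (cut K w side ∪ cap) (IsFrameVertex cap) := by
  have hold : ∀ {v p}, ¬ IsFrameVertex cap v → (graph (cut K w side ∪ cap)).Adj v p →
      ∃ x, v = .old x := by
    rintro v p hv ⟨-, F, hF, h, -⟩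
    obtain ⟨x, rfl, -⟩ := hc.old_of_vertex ⟨F, hF, h⟩ hv
    exact ⟨x, rfl⟩
  refine ⟨?_, ?_, ?_⟩
  · intro F' hF'
    rcases mem_cut_union.1 hF' with ⟨F, hF, rfl⟩ | h
    · rw [Finset.card_image_of_injective, hK.card_face F hF]
      exact Function.LeftInverse.injective (g := proj w) fun y => proj_liftVertex F y
    · exact hc.card_face F' h
  · intro v p hv hp
    obtain ⟨x, rfl⟩ := hold hv hp
    rw [← hK.link_degree x (proj w p) (hc.proj_adj hp)]
    have himg : (link K x).neighborSet (proj w p) =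
        proj w '' (link (cut K w side ∪ cap) (.old x)).neighborSet p := by
      ext y
      constructor
      · intro h
        obtain ⟨q, hq, e⟩ := hc.link_lift hp h
        exact ⟨q, hq, e⟩
      · rintro ⟨q, hq, rfl⟩
        exact hc.link_proj hq
    rw [himg, Set.InjOn.ncard_image]
    intro q hq r hr e
    exact hc.lift_unique (adj_of_link_adj (SimpleGraph.Adj.symm hq))
      (adj_of_link_adj (SimpleGraph.Adj.symm hr)) e
  · intro v p q hv hp hq
    obtain ⟨x, rfl⟩ := hold hv hp
    have : proj w q ∈ {y | ∃ r, proj w r = y ∧ (graph (cut K w side ∪ cap)).Adj (.old x) r ∧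
        (link (cut K w side ∪ cap) (.old x)).Reachable p r} := by
      refine mem_of_reachable_of_closed ?_
        (hK.link_connected x _ _ (hc.proj_adj hp) (hc.proj_adj hq)) ⟨p, rfl, hp, .refl _⟩
      rintro y ⟨r, rfl, hr, hpr⟩ z hz
      obtain ⟨q', ht, rfl⟩ := hc.link_lift hr hz
      exact ⟨q', rfl, adj_of_link_adj ht.symm, hpr.trans ht.reachable⟩
    obtain ⟨r, e, hr, hpr⟩ := this
    exact hc.lift_unique hr hq e ▸ hpr

theorem isCovered (hK : IsTriangulation K)
    (hT : ∀ a b, (graph K).Adj a b → ∃ C, IsNonfacial K C ∧ a ∈ C ∧ b ∈ C) :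
    IsCovered cap (cut K w side ∪ cap) := by
  refine ⟨hc.isSurfaceOff hK, ?_, ?_⟩
  · have main : ∀ x p, (graph (cut K w side ∪ cap)).Adj (.old x) p →
        (∃ i, EdgeOnRoute (cut K w side ∪ cap) i (.old x) p) ∨
        ∃ C, IsNonfacial (cut K w side ∪ cap) C ∧
          IsTightAround (cut K w side ∪ cap) (IsFrameVertex cap) C ∧ .old x ∈ C ∧ p ∈ C := by
      intro x p hp
      obtain ⟨q, hq, -, hpq, hN | ⟨-, ⟨i, s, rfl | rfl⟩, hbp, hbq⟩⟩ := hc.exists_third_lift hT hp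
      · exact Or.inr ⟨_, hN, hc.isTightAround hT hN, by simp, by simp⟩
      · exact Or.inl ⟨i, (onRoute_of_broken hq hp hpq.symm (hbp i s rfl)).2.1⟩
      · exact Or.inl ⟨i, (onRoute_of_broken hp hq hpq (hbq i s rfl)).1⟩
    intro p q hpq
    rcases hc.frameEdge_or_old hpq with h | ⟨x, rfl⟩ | ⟨x, rfl⟩
    · exact Or.inl h
    · exact Or.inr (main x q hpq)
    · rcases main x p hpq.symm with ⟨i, h⟩ | ⟨C, h1, h2, h3, h4⟩
      · exact Or.inr (Or.inl ⟨i, h.symm⟩)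
      · exact Or.inr (Or.inr ⟨C, h1, h2, h4, h3⟩)
  · intro p hpv
    by_cases hpf : IsFrameVertex cap p
    · exact Or.inl hpf
    obtain ⟨x, rfl, hxw, hxv⟩ := hc.old_of_vertex hpv hpf
    by_cases hN : ∃ C, IsNonfacial (cut K w side ∪ cap) C ∧ .old x ∈ C
    · obtain ⟨C, hC, hx⟩ := hN
      exact Or.inr (Or.inr ⟨C, hC, hc.isTightAround hT hC, hx⟩)
    right; left
    -- With no nonfacial 3-cycle at `old x`, the 3-cycle for each of its edges breaks, and does so
    -- at a copy adjacent to `old x`.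
    have hbroken : ∀ p, (graph (cut K w side ∪ cap)).Adj (.old x) p →
        ∃ q, (graph (cut K w side ∪ cap)).Adj (.old x) q ∧
          ({x, proj w p, proj w q} : Finset V) ∉ K ∧
          ∃ i s, (p = copy i s ∨ q = copy i s) ∧
            VertexOnRoute (cut K w side ∪ cap) i (.old x) := by
      intro p hp
      obtain ⟨q, hq, hK', hpq, hN' | ⟨-, ⟨i, s, rfl | rfl⟩, hbp, hbq⟩⟩ :=
        hc.exists_third_lift hT hp
      · exact absurd ⟨_, hN', by simp⟩ hN
      · exact ⟨q, hq, hK', i, s, Or.inl rfl, (onRoute_of_broken hq hp hpq.symm (hbp i s rfl)).2.2⟩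
      · exact ⟨_, hq, hK', i, s, Or.inr rfl, (onRoute_of_broken hp hq hpq (hbq i s rfl)).2.2⟩
    obtain ⟨F, hF, hxF⟩ := hxv
    obtain ⟨y, hyF, hyx⟩ := Finset.exists_mem_ne
      (by rw [hK.card_face F hF]; omega : 1 < F.card) x
    obtain ⟨p, hp, -⟩ := hc.exists_lift hxw (adj_of_face hF hxF hyF hyx.symm)
    obtain ⟨q, hq, -, i, s, hor, hri⟩ := hbroken p hp
    have hi : (graph (cut K w side ∪ cap)).Adj (.old x) (copy i s) := by
      rcases hor with rfl | rfl <;> assumption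
    have hi' := hc.proj_adj hi
    rw [proj_copy] at hi'
    -- For a second index, take a face with vertices `x`, `w i`, `b` and a 3-cycle for the edge
    -- `xb`. It is nonfacial, so its third vertex is not `w i`, and it must break at some other `w
    -- j`.
    obtain ⟨b, -, hb⟩ := (hK.isSurfaceOff fun _ => False).exists_face_avoiding (by simp) hi' x
    obtain ⟨p', hp', rfl⟩ := hc.exists_lift hxw (adj_of_link_adj hb.symm)
    obtain ⟨q', hq', hnf, j, s', hor', hrj⟩ := hbroken p' hp'
    have hij : i ≠ j := by
      rintro rfl
      rcases hor' with rfl | rfl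
      · rw [proj_copy] at hb
        exact hb.ne rfl
      · rw [proj_copy] at hnf
        apply hnf
        convert ((link_adj_iff hK.card_face).1 hb).2.2.2 using 1
        ext; simp; tauto
    rcases lt_or_gt_of_ne hij with h | h
    · exact ⟨i, j, h, hri, hrj⟩
    · exact ⟨j, i, h, hrj, hri⟩

end IsCapping

end CutCapBase

end SurfTri

theorem theorem2 {V : Type*} [DecidableEq V]
    (T : SurfTri.FaceSet V) (hT : SurfTri.IsIrreducible T) (hsphere : SurfTri.eulerGenus T ≠ 0)
    (w : Fin 3 → V) (hw : SurfTri.IsThreeCycle T w) (hns : SurfTri.IsNonseparating T w)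
    (T' cap : SurfTri.FaceSet (SurfTri.CutVertex V)) (hT' : SurfTri.IsCutCap T w T' cap)
    (T'' : SurfTri.FaceSet (SurfTri.CutVertex V))
    (hT'' : Relation.ReflTransGen (SurfTri.InteriorContraction cap) T' T'') :
    (∀ x y, (SurfTri.graph T'').Adj x y →
      SurfTri.IsFrameEdge cap x y ∨
      ¬ SurfTri.IsContractible T'' x y ∨
      ∃ i, SurfTri.EdgeOnShortPath T'' i x y) ∧
    (∀ x, SurfTri.IsVertex T'' x →
      SurfTri.IsFrameVertex cap x ∨
      (∃ y, (SurfTri.graph T'').Adj x y ∧ ¬ SurfTri.IsContractible T'' x y) ∨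
      ∃ i j, i < j ∧ SurfTri.VertexOnShortPath T'' i x ∧ SurfTri.VertexOnShortPath T'' j x) := by
  obtain ⟨side, rfl, hc⟩ := hT'.exists_isCapping hw
  have hcov : SurfTri.IsCovered cap T'' :=
    (hc.isCovered hT.triangulation fun a b h => hT.exists_isNonfacial hsphere h)
      |>.of_interiorContractions (fun i => hc.frame_copy i true) (fun i => hc.frame_copy i false)
        hT''
  have hcard := hcov.surface.card_face
  constructor
  · intro x y hxy
    rcases hcov.edge x y hxy with h | ⟨i, h⟩ | ⟨C, hC, -, hx, hy⟩
    · exact Or.inl h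
    · exact Or.inr (Or.inr ⟨i, h.edgeOnShortPath hxy.ne⟩)
    · exact Or.inr (Or.inl (SurfTri.not_isContractible_of_isNonfacial hcard hC hx hy))
  · intro x hx
    rcases hcov.vertex x hx with h | ⟨i, j, hij, h1, h2⟩ | ⟨C, hC, -, hxC⟩
    · exact Or.inl h
    · exact Or.inr (Or.inr ⟨i, j, hij, h1.vertexOnShortPath, h2.vertexOnShortPath⟩)
    · obtain ⟨y, hy, hyx⟩ := Finset.exists_mem_ne (by rw [hC.1]; omega : 1 < C.card) x
      exact Or.inr (Or.inl ⟨y, hC.2.2 x hxC y hy hyx.symm,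
        SurfTri.not_isContractible_of_isNonfacial hcard hC hxC hy⟩)
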